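/- Let $\epsilon>0$ and $\nu>0$ be real constants and let $\mathbf k=(k_x,k_y)\in\mathbb R^2$ be a unit vector with $k_x>0$ and $k_y\neq 0$. Let $\mathcal F_y$ denote the Fourier transform in $y$, normalised by $\mathcal F_y(f;\eta)=\int_{\mathbb R}e^{-i\eta y}f(y)\,dy$ and extended to the space $\mathcal S'(\mathbb R)$ of tempered distributions, and let $\sqrt{\ }$ be the principal square root. Set $$R_-(i\eta)=i\frac{k_x\eta}{k_y}-i\frac{k_x}{\epsilon k_y^2}\left(1-\sqrt{1-2\frac{\epsilon k_y\eta}{k_x^2}+2i\nu\frac{\epsilon k_y^2}{k_x^2}}\right),\qquad \eta\in\mathbb R .$$ Then $\operatorname{Re}R_-(i\eta)<0$ for all $\eta\in\mathbb R$. For every $g\in\mathcal S'(\mathbb R)$ there is exactly one continuous function $u:[0,\infty)\to\mathcal S'(\mathbb R)$, $x\mapsto u(x,\cdot)$, such that (i) the extension of $u$ by zero to $x<0$, i.e. $\Phi\mapsto\int_0^\infty\langle u(x,\cdot),\Phi(x,\cdot)\rangle\,dx$ for $\Phi\in C_c^\infty(\mathbb R^2)$, is a tempered distribution on $\mathbb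 R^2$; (ii) in the sense of distributions on the half-plane $\{x>0\}$, $$i(k_x\partial_x+k_y\partial_y)u+\frac{\epsilon}{2}\left(k_x^2\partial_{yy}-2k_xk_y\partial_{xy}+k_y^2\partial_{xx}\right)u+i\nu u=0;$$ (iii) $u$ has a one-sided derivative $\partial_xu$ at $x=0$ in $\mathcal S'(\mathbb R)$, and at $x=0$ $$i\epsilon k_y(k_x\partial_y-k_y\partial_x)u+2k_xu=2k_xg .$$ For every $x\ge 0$ this solution is given by $$\mathcal F_y(u;x,\eta)=\frac{2\,\mathcal F_y(g;\eta)}{1+\sqrt{1-2\frac{\epsilon k_y\eta}{k_x^2}+2i\nu\frac{\epsilon k_y^2}{k_x^2}}}\;e^{R_-(i\eta)x},$$ where the factor multiplying $\mathcal F_y(g;\eta)$ and the function $\eta\mapsto R_-(i\eta)$ are smooth functions of $\eta$ all of whose derivatives have at most polynomial growth, so that the products are defined in $\mathcal S'(\mathbb R)$. Moreover $(\partial_x-R_-(i\eta))\mathcal F_y(u;x,\eta)=0$ in $\mathcal S'(\mathbb R)$ for all $x\ge0$ (with the one-sided derivative at $x=0$). -/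

import Mathlib

open MeasureTheory
open scoped SchwartzMap NNReal LineDeriv FourierTransform

noncomputable section

namespace TiltedParaxial

/-- The restriction `Φ(x, ·)` of a Schwartz function of `(x, y)` to a vertical line. -/
def slice (x : ℝ) : 𝓢(ℝ × ℝ, ℂ) →L[ℂ] 𝓢(ℝ, ℂ) :=
  SchwartzMap.compCLMOfAntilipschitz ℂ (K := 1) (g := fun y : ℝ => (x, y))
    (by
      have h : (fun y : ℝ => (x, y)) =
          (fun _ : ℝ => ((x, 0) : ℝ × ℝ)) + ⇑(ContinuousLinearMap.inr ℝ ℝ ℝ) := by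
        funext y; simp
      rw [h]
      exact (Function.HasTemperateGrowth.const _).add
        (ContinuousLinearMap.inr ℝ ℝ ℝ).hasTemperateGrowth)
    (AntilipschitzWith.of_le_mul_dist fun a b => by simp [Prod.dist_eq])

@[simp]
theorem slice_apply (x y : ℝ) (Φ : 𝓢(ℝ × ℝ, ℂ)) : slice x Φ y = Φ (x, y) := rfl

/-- The Fourier transform `(F ψ)(η) = ∫ e^{-iηy} ψ(y) dy` on Schwartz functions. -/
def schwartzFourier : 𝓢(ℝ, ℂ) →L[ℂ] 𝓢(ℝ, ℂ) :=
  (SchwartzMap.compCLMOfContinuousLinearEquiv ℂ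
      (ContinuousLinearEquiv.unitsEquivAut ℝ
        (Units.mk0 (2 * Real.pi)⁻¹ (inv_ne_zero Real.two_pi_pos.ne')))).comp
    (FourierTransform.fourierCLM ℂ 𝓢(ℝ, ℂ))

theorem schwartzFourier_apply (ψ : 𝓢(ℝ, ℂ)) (η : ℝ) :
    schwartzFourier ψ η = ∫ y : ℝ, Complex.exp (-(Complex.I * η * y)) * ψ y := by
  have h : schwartzFourier ψ η = 𝓕 (ψ : ℝ → ℂ) (η * (2 * Real.pi)⁻¹) := rfl
  rw [h, Real.fourier_eq']
  refine integral_congr_ae (Filter.Eventually.of_forall fun y => ?_)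
  have hp : (Real.pi : ℂ) ≠ 0 := by exact_mod_cast Real.pi_ne_zero
  simp only [smul_eq_mul]
  congr 2
  simp only [RCLike.inner_apply, conj_trivial]
  push_cast
  field_simp

/-- The Fourier transform in `y` on tempered distributions, `⟨F T, ψ⟩ = ⟨T, F ψ⟩`
(so that `∂_y` becomes multiplication by `iη`). -/
def fourierY : 𝓢'(ℝ, ℂ) →L[ℂ] 𝓢'(ℝ, ℂ) :=
  PointwiseConvergenceCLM.precomp ℂ schwartzFourier

@[simp]
theorem fourierY_apply (T : 𝓢'(ℝ, ℂ)) (ψ : 𝓢(ℝ, ℂ)) :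
    fourierY T ψ = T (schwartzFourier ψ) := rfl

/-- `√(1 - 2 ε k_y η / k_x² + 2 i ν ε k_y² / k_x²)`, with the principal square root. -/
def rootS (ε ν kx ky η : ℝ) : ℂ :=
  Complex.sqrt (1 - 2 * (ε * ky * η / kx ^ 2) + 2 * Complex.I * ν * (ε * ky ^ 2 / kx ^ 2))

/-- `R₋(iη)`, as a function of the real frequency `η`. -/
def Rminus (ε ν kx ky η : ℝ) : ℂ :=
  Complex.I * (kx * η / ky) - Complex.I * (kx / (ε * ky ^ 2)) * (1 - rootS ε ν kx ky η)

/-- The factor `2 / (1 + √(…)) · e^{R₋(iη) x}` that maps `F_y g` to `F_y u(x, ·)`. -/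
def propagator (ε ν kx ky x η : ℝ) : ℂ :=
  2 / (1 + rootS ε ν kx ky η) * Complex.exp (Rminus ε ν kx ky η * x)

/-- The differential operator
`i(k_x ∂_x + k_y ∂_y) + ε/2 (k_x² ∂_yy - 2 k_x k_y ∂_xy + k_y² ∂_xx) + iν`
on tempered distributions on the plane. -/
def paraxialOp (ε ν kx ky : ℝ) (V : 𝓢'(ℝ × ℝ, ℂ)) : 𝓢'(ℝ × ℝ, ℂ) :=
  let ex : ℝ × ℝ := (1, 0)
  let ey : ℝ × ℝ := (0, 1)
  Complex.I • ((kx : ℂ) • ∂_{ex} V + (ky : ℂ) • ∂_{ey} V)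
    + ((ε : ℂ) / 2) • (((kx : ℂ) ^ 2) • ∂_{ey} (∂_{ey} V)
        - (2 * (kx : ℂ) * ky) • ∂_{ex} (∂_{ey} V)
        + ((ky : ℂ) ^ 2) • ∂_{ex} (∂_{ex} V))
    + (Complex.I * ν) • V

/-- `V` is the distribution `1_{x>0} u(x, ·)` on the plane, that is
`⟨V, Φ⟩ = ∫_{x>0} ⟨u(x), Φ(x, ·)⟩ dx` for all test functions `Φ`. As `V` is a tempered
distribution, this says that the extension of `u` by zero is tempered. -/
def IsZeroExtension (u : ℝ≥0 → 𝓢'(ℝ, ℂ)) (V : 𝓢'(ℝ × ℝ, ℂ)) : Prop :=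
  ∀ Φ : 𝓢(ℝ × ℝ, ℂ), HasCompactSupport Φ →
    V Φ = ∫ x in Set.Ioi (0 : ℝ), u x.toNNReal (slice x Φ)

/-- `w` is the derivative at `x ≥ 0` (one-sided if `x = 0`) of the curve `u : [0, ∞) → 𝓢'(ℝ)`. -/
def HasXDerivAt (u : ℝ≥0 → 𝓢'(ℝ, ℂ)) (w : 𝓢'(ℝ, ℂ)) (x : ℝ≥0) : Prop :=
  ∀ ψ : 𝓢(ℝ, ℂ),
    HasDerivWithinAt (fun t : ℝ => u t.toNNReal ψ) (w ψ) (Set.Ici 0) (x : ℝ)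

/-- `u`, a continuous function from `[0, ∞)` to `𝓢'(ℝ)`, solves the tilted paraxial problem in the
half-plane `x > 0` with incoming datum `g`. -/
structure IsSolution (ε ν kx ky : ℝ) (g : 𝓢'(ℝ, ℂ)) (u : C(ℝ≥0, 𝓢'(ℝ, ℂ))) : Prop where
  /-- The extension of `u` by zero is tempered, and the equation holds in the sense of
  distributions on the open half-plane. -/
  equation : ∃ V : 𝓢'(ℝ × ℝ, ℂ), IsZeroExtension u V ∧
    ∀ Φ : 𝓢(ℝ × ℝ, ℂ), HasCompactSupport Φ → tsupport Φ ⊆ {p : ℝ × ℝ | 0 < p.1} →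
      paraxialOp ε ν kx ky V Φ = 0
  /-- `∂_x u` has a trace at `x = 0`, and
  `iε k_y (k_x ∂_y - k_y ∂_x) u + 2 k_x u = 2 k_x g` there. -/
  boundary : ∃ w₀ : 𝓢'(ℝ, ℂ), HasXDerivAt u w₀ 0 ∧
    (Complex.I * ε * ky) •
        ((kx : ℂ) • TemperedDistribution.derivCLM ℂ (u 0) - (ky : ℂ) • w₀)
      + (2 * (kx : ℂ)) • u 0 = (2 * (kx : ℂ)) • g

end TiltedParaxial

end

noncomputable section

namespace TiltedParaxial

open Filter Topology

/-! ### Temperate growth of functions on the line -/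

theorem hasTemperateGrowth_of_iteratedDeriv {f : ℝ → ℂ} (hd : ∀ n, Differentiable ℝ (iteratedDeriv n f))
    (hb : ∀ n, ∃ (k : ℕ) (C : ℝ), ∀ x, ‖iteratedDeriv n f x‖ ≤ C * (1 + ‖x‖) ^ k) :
    f.HasTemperateGrowth := by
  refine ⟨contDiff_of_differentiable_iteratedDeriv fun m _ => hd m, fun n => ?_⟩
  simpa only [norm_iteratedFDeriv_eq_norm_iteratedDeriv] using hb n

theorem _root_.Function.HasTemperateGrowth.norm_iteratedDeriv_le {f : ℝ → ℂ}
    (hf : f.HasTemperateGrowth) (n : ℕ) :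
    ∃ (k : ℕ) (C : ℝ), ∀ x, ‖iteratedDeriv n f x‖ ≤ C * (1 + ‖x‖) ^ k := by
  simpa only [norm_iteratedFDeriv_eq_norm_iteratedDeriv] using hf.2 n

theorem _root_.Function.HasTemperateGrowth.norm_le {f : ℝ → ℂ} (hf : f.HasTemperateGrowth) :
    ∃ (k : ℕ) (C : ℝ), 0 ≤ C ∧ ∀ x, ‖f x‖ ≤ C * (1 + ‖x‖) ^ k := by
  obtain ⟨k, C, h⟩ := hf.norm_iteratedDeriv_le 0
  simp only [iteratedDeriv_zero] at h
  refine ⟨k, C, ?_, h⟩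
  have := (norm_nonneg _).trans (h 0)
  simpa using this

theorem _root_.Function.HasTemperateGrowth.differentiable {f : ℝ → ℂ} (hf : f.HasTemperateGrowth) :
    Differentiable ℝ f :=
  hf.1.differentiable (by simp)

theorem _root_.Function.HasTemperateGrowth.deriv {f : ℝ → ℂ} (hf : f.HasTemperateGrowth) :
    (deriv f).HasTemperateGrowth := by
  refine hasTemperateGrowth_of_iteratedDeriv (fun n => ?_) fun n => ?_
  · rw [← iteratedDeriv_succ']
    exact hf.1.differentiable_iteratedDeriv (n + 1) (WithTop.coe_lt_coe.2 (ENat.natCast_lt_top _))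
  · rw [← iteratedDeriv_succ']
    exact hf.norm_iteratedDeriv_le (n + 1)

/-- A polynomially bounded solution of `f' = g f` has temperate growth if `g` has. -/
theorem hasTemperateGrowth_of_hasDerivAt_mul {f g : ℝ → ℂ} (hg : g.HasTemperateGrowth)
    (hf : ∀ x, HasDerivAt f (g x * f x) x) {k : ℕ} {C : ℝ}
    (hb : ∀ x, ‖f x‖ ≤ C * (1 + ‖x‖) ^ k) : f.HasTemperateGrowth := by
  have key : ∀ n, ∃ h : ℝ → ℂ, h.HasTemperateGrowth ∧ iteratedDeriv n f = fun x => h x * f x := by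
    intro n
    induction n with
    | zero => exact ⟨fun _ => 1, .const 1, by simp⟩
    | succ n ih =>
      obtain ⟨h, hh, e⟩ := ih
      refine ⟨fun x => deriv h x + h x * g x, hh.deriv.add (hh.mul hg), ?_⟩
      rw [iteratedDeriv_succ, e]
      funext x
      refine (((hh.differentiable x).hasDerivAt.mul (hf x)).congr_deriv ?_).deriv
      ring
  refine hasTemperateGrowth_of_iteratedDeriv (fun n => ?_) fun n => ?_
  · obtain ⟨h, hh, e⟩ := key n
    rw [e]
    exact hh.differentiable.mul fun x => (hf x).differentiableAt
  · obtain ⟨h, hh, e⟩ := key n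
    obtain ⟨l, D, hD, hb'⟩ := hh.norm_le
    refine ⟨l + k, D * C, fun x => ?_⟩
    rw [e, norm_mul, pow_add]
    calc ‖h x‖ * ‖f x‖ ≤ (D * (1 + ‖x‖) ^ l) * (C * (1 + ‖x‖) ^ k) :=
          mul_le_mul (hb' x) (hb x) (norm_nonneg _) (by positivity)
      _ = _ := by ring

theorem hasTemperateGrowth_inv {f : ℝ → ℂ} (hf : f.HasTemperateGrowth) {c : ℝ} (hc : 0 < c)
    (hb : ∀ x, c ≤ ‖f x‖) : (fun x => (f x)⁻¹).HasTemperateGrowth := by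
  have h0 : ∀ x, f x ≠ 0 := fun x => norm_pos_iff.1 (hc.trans_le (hb x))
  have hi : ∀ x, ‖(f x)⁻¹‖ ≤ c⁻¹ := fun x => by
    rw [norm_inv]
    exact inv_anti₀ hc (hb x)
  have hd : ∀ x, HasDerivAt (fun x => (f x)⁻¹) (-deriv f x / f x ^ 2) x := fun x =>
    (hf.differentiable x).hasDerivAt.inv (h0 x)
  have key : ∀ n, ∃ h : ℝ → ℂ, h.HasTemperateGrowth ∧
      iteratedDeriv n (fun x => (f x)⁻¹) = fun x => h x * (f x)⁻¹ ^ (n + 1) := by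
    intro n
    induction n with
    | zero => exact ⟨fun _ => 1, .const 1, by simp⟩
    | succ n ih =>
      obtain ⟨h, hh, e⟩ := ih
      refine ⟨fun x => deriv h x * f x - (n + 1 : ℂ) * h x * deriv f x,
        (hh.deriv.mul hf).sub (((Function.HasTemperateGrowth.const _).mul hh).mul hf.deriv), ?_⟩
      rw [iteratedDeriv_succ, e]
      funext x
      refine (((hh.differentiable x).hasDerivAt.mul ((hd x).pow (n + 1))).congr_deriv ?_).deriv
      have := h0 x
      simp only [Nat.add_sub_cancel, Pi.pow_apply, inv_pow]
      push_cast
      field_simp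
      ring
  refine hasTemperateGrowth_of_iteratedDeriv (fun n => ?_) fun n => ?_
  · obtain ⟨h, hh, e⟩ := key n
    rw [e]
    exact hh.differentiable.mul (Differentiable.pow (fun x => (hd x).differentiableAt) _)
  · obtain ⟨h, hh, e⟩ := key n
    obtain ⟨l, D, hD, hb'⟩ := hh.norm_le
    refine ⟨l, D * c⁻¹ ^ (n + 1), fun x => ?_⟩
    rw [e, norm_mul, norm_pow]
    calc ‖h x‖ * ‖(f x)⁻¹‖ ^ (n + 1) ≤ (D * (1 + ‖x‖) ^ l) * c⁻¹ ^ (n + 1) := by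
          gcongr
          · exact hb' x
          · exact hi x
      _ = _ := by ring

theorem hasTemperateGrowth_cexp {h : ℝ → ℂ} (hh : h.HasTemperateGrowth) (hre : ∀ x, (h x).re ≤ 0)
    {s : ℝ} (hs : 0 ≤ s) : (fun x => Complex.exp (h x * s)).HasTemperateGrowth := by
  refine hasTemperateGrowth_of_hasDerivAt_mul (g := fun x => deriv h x * s) (k := 0) (C := 1)
    (hh.deriv.mul (.const _)) (fun x => ?_) fun x => ?_
  · have := ((hh.differentiable x).hasDerivAt.mul_const (s : ℂ)).cexp
    rwa [mul_comm] at this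
  · rw [Complex.norm_exp]
    simpa using mul_nonpos_of_nonpos_of_nonneg (hre x) hs

/-! ### Seminorms and convergence in the Schwartz space of the line -/

theorem seminorm_succ (k n : ℕ) (f : 𝓢(ℝ, ℂ)) :
    SchwartzMap.seminorm ℂ k (n + 1) f =
      SchwartzMap.seminorm ℂ k n (SchwartzMap.derivCLM ℂ ℂ f) := by
  have e : iteratedDeriv (n + 1) f = iteratedDeriv n (SchwartzMap.derivCLM ℂ ℂ f) := by
    rw [iteratedDeriv_succ']; rfl
  refine le_antisymm ?_ ?_
  · refine SchwartzMap.seminorm_le_bound' ℂ _ _ _ (apply_nonneg _ _) fun x => ?_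
    rw [e]
    exact SchwartzMap.le_seminorm' ℂ k n _ x
  · refine SchwartzMap.seminorm_le_bound' ℂ _ _ _ (apply_nonneg _ _) fun x => ?_
    rw [← e]
    exact SchwartzMap.le_seminorm' ℂ k (n + 1) _ x

theorem seminorm_zero_le {k : ℕ} {f : 𝓢(ℝ, ℂ)} {M : ℝ} (hM : 0 ≤ M)
    (h : ∀ x, |x| ^ k * ‖f x‖ ≤ M) : SchwartzMap.seminorm ℂ k 0 f ≤ M :=
  SchwartzMap.seminorm_le_bound' ℂ _ _ _ hM (by simpa using h)

theorem continuous_seminorm (k n : ℕ) :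
    Continuous (SchwartzMap.seminorm ℂ k n : Seminorm ℂ 𝓢(ℝ, ℂ)) :=
  (schwartz_withSeminorms ℂ ℝ ℂ).continuous_seminorm (k, n)

theorem tendsto_schwartz_iff {ι : Type*} {l : Filter ι} {c : ι → 𝓢(ℝ, ℂ)} {φ : 𝓢(ℝ, ℂ)} :
    Tendsto c l (𝓝 φ) ↔
      ∀ k n, Tendsto (fun i => SchwartzMap.seminorm ℂ k n (c i - φ)) l (𝓝 0) := by
  constructor
  · intro h k n
    have := ((continuous_seminorm k n).tendsto _).comp (h.sub_const φ)
    simpa [Function.comp_def] using this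
  · intro h
    rw [(schwartz_withSeminorms ℂ ℝ ℂ).tendsto_nhds]
    intro ⟨k, n⟩ ε hε
    exact (h k n).eventually (gt_mem_nhds hε)

/-- Continuous seminorms control the functionals that are bounded by them. -/
theorem exists_seminorm_bound (T : 𝓢(ℝ, ℂ) →L[ℂ] ℂ) :
    ∃ q : Seminorm ℂ 𝓢(ℝ, ℂ), Continuous q ∧ ∀ φ, ‖T φ‖ ≤ q φ :=
  ⟨(normSeminorm ℂ ℂ).comp T.toLinearMap, by
    change Continuous fun φ => ‖T φ‖
    fun_prop, fun _ => le_rfl⟩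

/-! ### Completeness of the Schwartz space of the line -/

theorem iteratedDeriv_eq_iterate_derivCLM (n : ℕ) (f : 𝓢(ℝ, ℂ)) :
    iteratedDeriv n f = ((SchwartzMap.derivCLM ℂ ℂ)^[n] f : 𝓢(ℝ, ℂ)) := by
  induction n generalizing f with
  | zero => simp
  | succ n ih =>
    rw [iteratedDeriv_succ', Function.iterate_succ_apply, ← ih]
    rfl

theorem exists_tendsto_of_cauchySeq {u : ℕ → 𝓢(ℝ, ℂ)} (hu : CauchySeq u) :
    ∃ f, Tendsto u atTop (𝓝 f) := by
  have hc : ∀ k n, ∀ ε > 0, ∃ N, ∀ i ≥ N, ∀ j ≥ N,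
      SchwartzMap.seminorm ℂ k n (u i - u j) < ε := by
    intro k n ε hε
    have hV : {φ : 𝓢(ℝ, ℂ) | SchwartzMap.seminorm ℂ k n φ < ε} ∈ 𝓝 (0 : 𝓢(ℝ, ℂ)) := by
      refine (continuous_seminorm k n).continuousAt.eventually_lt continuousAt_const ?_
      simpa using hε
    rw [cauchySeq_iff] at hu
    obtain ⟨N, hN⟩ := hu {p | SchwartzMap.seminorm ℂ k n (p.2 - p.1) < ε} (by
      rw [uniformity_eq_comap_nhds_zero]
      exact ⟨_, hV, fun p hp => hp⟩)
    exact ⟨N, fun i hi j hj => hN j hj i hi⟩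
  have hpt : ∀ n x, CauchySeq fun i => iteratedDeriv n (u i) x := by
    intro n x
    rw [Metric.cauchySeq_iff]
    intro ε hε
    obtain ⟨N, hN⟩ := hc 0 n ε hε
    refine ⟨N, fun i hi j hj => (lt_of_le_of_lt ?_ (hN i hi j hj))⟩
    have := SchwartzMap.le_seminorm' ℂ 0 n (u i - u j) x
    rw [iteratedDeriv_eq_iterate_derivCLM, iterate_map_sub] at this
    rw [dist_eq_norm, iteratedDeriv_eq_iterate_derivCLM, iteratedDeriv_eq_iterate_derivCLM]
    simpa using this
  choose F hF using fun n x => cauchySeq_tendsto_of_complete (hpt n x)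
  have hlim : ∀ k n, ∀ ε > 0, ∃ N, ∀ i ≥ N, ∀ x,
      |x| ^ k * ‖iteratedDeriv n (u i) x - F n x‖ ≤ ε := by
    intro k n ε hε
    obtain ⟨N, hN⟩ := hc k n ε hε
    refine ⟨N, fun i hi x => ?_⟩
    refine le_of_tendsto ((tendsto_const_nhds.sub (hF n x)).norm.const_mul (|x| ^ k)) ?_
    filter_upwards [eventually_ge_atTop N] with j hj
    have := SchwartzMap.le_seminorm' ℂ k n (u i - u j) x
    rw [iteratedDeriv_eq_iterate_derivCLM, iterate_map_sub] at this
    rw [iteratedDeriv_eq_iterate_derivCLM, iteratedDeriv_eq_iterate_derivCLM]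
    exact this.trans (hN i hi j hj).le
  have hderiv : ∀ n x, HasDerivAt (F n) (F (n + 1) x) x := by
    intro n x
    refine hasDerivAt_of_tendstoUniformly (f := fun i => iteratedDeriv n (u i))
      (f' := fun i => iteratedDeriv (n + 1) (u i)) (l := atTop) ?_ ?_ (fun x => hF n x) x
    · rw [Metric.tendstoUniformly_iff]
      intro ε hε
      obtain ⟨N, hN⟩ := hlim 0 (n + 1) (ε / 2) (half_pos hε)
      filter_upwards [eventually_ge_atTop N] with i hi y
      rw [dist_comm, dist_eq_norm]
      have := hN i hi y
      rw [pow_zero, one_mul] at this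
      linarith
    · refine Eventually.of_forall fun i y => ?_
      rw [iteratedDeriv_succ]
      exact (((u i).smooth ⊤).differentiable_iteratedDeriv n
        (WithTop.coe_lt_coe.2 (ENat.natCast_lt_top _)) y).hasDerivAt
  have hFn : ∀ n, iteratedDeriv n (F 0) = F n := by
    intro n
    induction n with
    | zero => simp
    | succ n ih => rw [iteratedDeriv_succ, ih]; exact funext fun x => (hderiv n x).deriv
  let f : 𝓢(ℝ, ℂ) :=
    { toFun := F 0
      smooth' := contDiff_of_differentiable_iteratedDeriv fun m _ => by
        rw [hFn]; exact fun x => (hderiv m x).differentiableAt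
      decay' := fun k n => by
        obtain ⟨N, hN⟩ := hlim k n 1 one_pos
        refine ⟨SchwartzMap.seminorm ℂ k n (u N) + 1, fun x => ?_⟩
        rw [norm_iteratedFDeriv_eq_norm_iteratedDeriv, hFn, Real.norm_eq_abs]
        calc |x| ^ k * ‖F n x‖
            ≤ |x| ^ k * (‖iteratedDeriv n (u N) x‖ + ‖iteratedDeriv n (u N) x - F n x‖) := by
              gcongr
              calc ‖F n x‖ = ‖iteratedDeriv n (u N) x - (iteratedDeriv n (u N) x - F n x)‖ := by
                    congr 1; ring
                _ ≤ _ := norm_sub_le _ _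
          _ = |x| ^ k * ‖iteratedDeriv n (u N) x‖
                + |x| ^ k * ‖iteratedDeriv n (u N) x - F n x‖ := by ring
          _ ≤ _ := add_le_add (SchwartzMap.le_seminorm' ℂ k n (u N) x) (hN N le_rfl x) }
  refine ⟨f, tendsto_schwartz_iff.2 fun k n => ?_⟩
  rw [Metric.tendsto_atTop]
  intro ε hε
  obtain ⟨N, hN⟩ := hlim k n (ε / 2) (half_pos hε)
  refine ⟨N, fun i hi => ?_⟩
  rw [dist_zero_right, Real.norm_of_nonneg (apply_nonneg _ _)]
  refine lt_of_le_of_lt (SchwartzMap.seminorm_le_bound' ℂ k n _ (half_pos hε).le fun x => ?_)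
    (half_lt_self hε)
  have e : iteratedDeriv n (u i - f : 𝓢(ℝ, ℂ)) x = iteratedDeriv n (u i) x - F n x := by
    have h2 : iteratedDeriv n f = F n := hFn n
    rw [← h2, iteratedDeriv_eq_iterate_derivCLM, iteratedDeriv_eq_iterate_derivCLM,
      iteratedDeriv_eq_iterate_derivCLM, iterate_map_sub]
    rfl
  rw [e]
  exact hN i hi x

instance : CompleteSpace 𝓢(ℝ, ℂ) :=
  have : (uniformity 𝓢(ℝ, ℂ)).IsCountablyGenerated :=
    IsUniformAddGroup.uniformity_countably_generated
  UniformSpace.complete_of_cauchySeq_tendsto fun _ hu => exists_tendsto_of_cauchySeq hu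

instance : BarrelledSpace ℂ 𝓢(ℝ, ℂ) :=
  have : (uniformity 𝓢(ℝ, ℂ)).IsCountablyGenerated :=
    IsUniformAddGroup.uniformity_countably_generated
  letI := UniformSpace.pseudoMetricSpace 𝓢(ℝ, ℂ)
  inferInstance

/-- A pointwise bounded family of tempered distributions is bounded by a continuous seminorm. -/
theorem exists_seminorm_bound_of_pointwise {ι : Type*} (T : ι → 𝓢(ℝ, ℂ) →L[ℂ] ℂ)
    (hT : ∀ φ, ∃ C, ∀ i, ‖T i φ‖ ≤ C) :
    ∃ q : Seminorm ℂ 𝓢(ℝ, ℂ), Continuous q ∧ ∀ i φ, ‖T i φ‖ ≤ q φ := by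
  have h : UniformEquicontinuous ((↑) ∘ T) :=
    (norm_withSeminorms ℂ ℂ).banach_steinhaus fun _ φ => by
      obtain ⟨C, hC⟩ := hT φ
      exact ⟨C, by rintro _ ⟨i, rfl⟩; exact hC i⟩
  obtain ⟨q, hq, hb⟩ := ((norm_withSeminorms ℂ ℂ).uniformEquicontinuous_iff_exists_continuous_seminorm
    (fun i => (T i).toLinearMap)).1 h 0
  exact ⟨q, hq, fun i φ => hb i φ⟩

/-! ### Multiplication by `exp (h s)` on the Schwartz space -/

theorem smulLeft_apply {g : ℝ → ℂ} (hg : g.HasTemperateGrowth) (φ : 𝓢(ℝ, ℂ)) (x : ℝ) :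
    SchwartzMap.smulLeftCLM ℂ g φ x = g x * φ x :=
  SchwartzMap.smulLeftCLM_apply_apply hg φ x

theorem derivCLM_smulLeft {g : ℝ → ℂ} (hg : g.HasTemperateGrowth) (φ : 𝓢(ℝ, ℂ)) :
    SchwartzMap.derivCLM ℂ ℂ (SchwartzMap.smulLeftCLM ℂ g φ) =
      SchwartzMap.smulLeftCLM ℂ (deriv g) φ
        + SchwartzMap.smulLeftCLM ℂ g (SchwartzMap.derivCLM ℂ ℂ φ) := by
  ext x
  have e : ⇑(SchwartzMap.smulLeftCLM ℂ g φ) = fun x => g x * φ x := funext (smulLeft_apply hg φ)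
  simp only [SchwartzMap.derivCLM_apply, add_apply, smulLeft_apply hg,
    smulLeft_apply hg.deriv]
  rw [e]
  exact ((hg.differentiable x).hasDerivAt.mul (φ.hasDerivAt x)).deriv

theorem smulLeft_comm {g h : ℝ → ℂ} (hg : g.HasTemperateGrowth) (hh : h.HasTemperateGrowth)
    (φ : 𝓢(ℝ, ℂ)) :
    SchwartzMap.smulLeftCLM ℂ g (SchwartzMap.smulLeftCLM ℂ h φ) =
      SchwartzMap.smulLeftCLM ℂ h (SchwartzMap.smulLeftCLM ℂ g φ) := by
  ext x
  simp only [smulLeft_apply hg, smulLeft_apply hh]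
  ring

/-- Multiplication of a Schwartz function by `exp (h s)`. -/
def mulExp (h : ℝ → ℂ) (s : ℝ) : 𝓢(ℝ, ℂ) →L[ℂ] 𝓢(ℝ, ℂ) :=
  SchwartzMap.smulLeftCLM ℂ fun x => Complex.exp (h x * s)

section MulExp

variable {h : ℝ → ℂ}

theorem mulExp_apply (hh : h.HasTemperateGrowth) (hre : ∀ x, (h x).re ≤ 0) {s : ℝ} (hs : 0 ≤ s)
    (φ : 𝓢(ℝ, ℂ)) (x : ℝ) : mulExp h s φ x = Complex.exp (h x * s) * φ x :=
  smulLeft_apply (hasTemperateGrowth_cexp hh hre hs) φ x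

theorem mulExp_zero (h : ℝ → ℂ) (φ : 𝓢(ℝ, ℂ)) : mulExp h 0 φ = φ := by
  simp [mulExp]

theorem mulExp_comm (hh : h.HasTemperateGrowth) (hre : ∀ x, (h x).re ≤ 0) {s : ℝ} (hs : 0 ≤ s)
    {g : ℝ → ℂ} (hg : g.HasTemperateGrowth) (φ : 𝓢(ℝ, ℂ)) :
    mulExp h s (SchwartzMap.smulLeftCLM ℂ g φ) = SchwartzMap.smulLeftCLM ℂ g (mulExp h s φ) :=
  smulLeft_comm (hasTemperateGrowth_cexp hh hre hs) hg φ

theorem derivCLM_mulExp (hh : h.HasTemperateGrowth) (hre : ∀ x, (h x).re ≤ 0) {s : ℝ} (hs : 0 ≤ s)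
    (φ : 𝓢(ℝ, ℂ)) :
    SchwartzMap.derivCLM ℂ ℂ (mulExp h s φ) =
      mulExp h s (SchwartzMap.derivCLM ℂ ℂ φ)
        + (s : ℂ) • mulExp h s (SchwartzMap.smulLeftCLM ℂ (deriv h) φ) := by
  have hE := hasTemperateGrowth_cexp hh hre hs
  rw [mulExp, derivCLM_smulLeft hE, add_comm]
  congr 1
  ext x
  have : deriv (fun x => Complex.exp (h x * s)) x = Complex.exp (h x * s) * (deriv h x * s) :=
    ((hh.differentiable x).hasDerivAt.mul_const (s : ℂ)).cexp.deriv
  rw [smulLeft_apply hE.deriv, this]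
  change _ = (s : ℂ) * mulExp h s _ x
  rw [mulExp_apply hh hre hs, smulLeft_apply hh.deriv]
  ring

theorem norm_cexp_mul_le_one {z : ℂ} (hz : z.re ≤ 0) {s : ℝ} (hs : 0 ≤ s) :
    ‖Complex.exp (z * s)‖ ≤ 1 := by
  rw [Complex.norm_exp]
  simpa using mul_nonpos_of_nonpos_of_nonneg hz hs

theorem exists_seminorm_mulExp_le (hh : h.HasTemperateGrowth) (hre : ∀ x, (h x).re ≤ 0) (k n : ℕ) :
    ∃ q : Seminorm ℂ 𝓢(ℝ, ℂ), Continuous q ∧ ∀ s : ℝ, 0 ≤ s → ∀ φ,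
      SchwartzMap.seminorm ℂ k n (mulExp h s φ) ≤ (1 + s) ^ n * q φ := by
  induction n with
  | zero =>
    refine ⟨SchwartzMap.seminorm ℂ k 0, continuous_seminorm k 0, fun s hs φ => ?_⟩
    rw [pow_zero, one_mul]
    refine seminorm_zero_le (apply_nonneg _ _) fun x => ?_
    rw [mulExp_apply hh hre hs, norm_mul]
    calc |x| ^ k * (‖Complex.exp (h x * s)‖ * ‖φ x‖) ≤ |x| ^ k * (1 * ‖φ x‖) := by
          gcongr
          exact norm_cexp_mul_le_one (hre x) hs
      _ ≤ _ := by simpa using SchwartzMap.le_seminorm' ℂ k 0 φ x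
  | succ n ih =>
    obtain ⟨q, hq, hb⟩ := ih
    refine ⟨q.comp (SchwartzMap.derivCLM ℂ ℂ).toLinearMap
      + q.comp (SchwartzMap.smulLeftCLM ℂ (deriv h)).toLinearMap, ?_, fun s hs φ => ?_⟩
    · exact (hq.comp (SchwartzMap.derivCLM ℂ ℂ).continuous).add
        (hq.comp (SchwartzMap.smulLeftCLM ℂ (deriv h)).continuous)
    · rw [seminorm_succ, derivCLM_mulExp hh hre hs]
      refine (map_add_le_add _ _ _).trans ?_
      rw [map_smul_eq_mul, Complex.norm_real, Real.norm_of_nonneg hs]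
      have h1 := hb s hs (SchwartzMap.derivCLM ℂ ℂ φ)
      have h2 := hb s hs (SchwartzMap.smulLeftCLM ℂ (deriv h) φ)
      change _ ≤ (1 + s) ^ (n + 1) * (q (SchwartzMap.derivCLM ℂ ℂ φ)
        + q (SchwartzMap.smulLeftCLM ℂ (deriv h) φ))
      calc _ ≤ (1 + s) ^ n * q (SchwartzMap.derivCLM ℂ ℂ φ)
            + s * ((1 + s) ^ n * q (SchwartzMap.smulLeftCLM ℂ (deriv h) φ)) := by gcongr
        _ ≤ (1 + s) * ((1 + s) ^ n * q (SchwartzMap.derivCLM ℂ ℂ φ))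
            + (1 + s) * ((1 + s) ^ n * q (SchwartzMap.smulLeftCLM ℂ (deriv h) φ)) := by
          have h3 : 0 ≤ (1 + s) ^ n * q (SchwartzMap.derivCLM ℂ ℂ φ) :=
            mul_nonneg (by positivity) (apply_nonneg _ _)
          have h4 : 0 ≤ (1 + s) ^ n * q (SchwartzMap.smulLeftCLM ℂ (deriv h) φ) :=
            mul_nonneg (by positivity) (apply_nonneg _ _)
          nlinarith
        _ = _ := by ring

/-- The maps `exp (h s)` are bounded by a continuous seminorm, with polynomial growth in `s`,
after composition with a continuous seminorm. -/
theorem exists_seminorm_comp_mulExp_le (hh : h.HasTemperateGrowth) (hre : ∀ x, (h x).re ≤ 0)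
    {p : Seminorm ℂ 𝓢(ℝ, ℂ)} (hp : Continuous p) :
    ∃ (N : ℕ) (q : Seminorm ℂ 𝓢(ℝ, ℂ)), Continuous q ∧ ∀ s : ℝ, 0 ≤ s → ∀ φ,
      p (mulExp h s φ) ≤ (1 + s) ^ N * q φ := by
  obtain ⟨S, C, -, hpC⟩ := Seminorm.bound_of_continuous (schwartz_withSeminorms ℂ ℝ ℂ) p hp
  choose Q hQ hb using fun kn : ℕ × ℕ => exists_seminorm_mulExp_le hh hre kn.1 kn.2
  refine ⟨S.sup Prod.snd, C • ∑ i ∈ S, Q i, ?_, fun s hs φ => ?_⟩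
  · have : Continuous fun φ => (C : ℝ) * ∑ i ∈ S, Q i φ :=
      continuous_const.mul (continuous_finsetSum _ fun i _ => hQ i)
    convert this using 2 with φ
    simp [NNReal.smul_def]
  · have h1 := (hpC (mulExp h s φ)).trans
      (show _ ≤ (C : ℝ) * ∑ i ∈ S, SchwartzMap.seminorm ℂ i.1 i.2 (mulExp h s φ) from by
        have := Seminorm.finset_sup_le_sum (schwartzSeminormFamily ℂ ℝ ℂ) S (mulExp h s φ)
        refine mul_le_mul_of_nonneg_left (this.trans ?_) C.2
        simp [schwartzSeminormFamily])
    have h2 : (C • ∑ i ∈ S, Q i) φ = (C : ℝ) * ∑ i ∈ S, Q i φ := by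
      simp [NNReal.smul_def]
    rw [h2]
    calc _ ≤ _ := h1
      _ ≤ (C : ℝ) * ∑ i ∈ S, (1 + s) ^ S.sup Prod.snd * Q i φ := by
        gcongr with i hi
        refine (hb i s hs φ).trans (mul_le_mul_of_nonneg_right ?_ (apply_nonneg _ _))
        exact pow_le_pow_right₀ (by linarith) (Finset.le_sup (f := Prod.snd) hi)
      _ = _ := by rw [← Finset.mul_sum]; ring

theorem norm_cexp_sub_le {z : ℂ} (hz : z.re ≤ 0) {s t : ℝ} (hs : 0 ≤ s) (ht : 0 ≤ t) :
    ‖Complex.exp (z * s) - Complex.exp (z * t)‖ ≤ ‖z‖ * |s - t| := by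
  have hd : ∀ r : ℝ, HasDerivAt (fun r : ℝ => Complex.exp (z * r)) (Complex.exp (z * r) * z) r :=
    fun r => by simpa using ((Complex.ofRealCLM.hasDerivAt (x := r)).const_mul z).cexp
  refine (convex_Ici (0 : ℝ)).norm_image_sub_le_of_norm_hasDerivWithin_le
    (f := fun r : ℝ => Complex.exp (z * r)) (f' := fun r : ℝ => Complex.exp (z * r) * z)
    (fun r _ => (hd r).hasDerivWithinAt) (fun r hr => ?_) ht hs
  rw [norm_mul]
  exact mul_le_of_le_one_left (norm_nonneg _) (norm_cexp_mul_le_one hz hr)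

theorem norm_cexp_sub_sub_le {z : ℂ} (hz : z.re ≤ 0) {s t : ℝ} (hs : 0 ≤ s) (ht : 0 ≤ t) :
    ‖Complex.exp (z * s) - Complex.exp (z * t) - (s - t) * (z * Complex.exp (z * t))‖
      ≤ ‖z‖ ^ 2 * (s - t) ^ 2 := by
  have hd : ∀ r : ℝ, HasDerivAt (fun r : ℝ => Complex.exp (z * r) - r * (z * Complex.exp (z * t)))
      (Complex.exp (z * r) * z - z * Complex.exp (z * t)) r := fun r => by
    have h1 := (Complex.ofRealCLM.hasDerivAt (x := r))
    refine ((h1.const_mul z).cexp.sub (h1.mul_const (z * Complex.exp (z * t)))).congr_deriv ?_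
    simp
  have := (convex_uIcc t s).norm_image_sub_le_of_norm_hasDerivWithin_le
    (C := ‖z‖ ^ 2 * |s - t|) (fun r _ => (hd r).hasDerivWithinAt) (fun r hr => ?_)
    Set.left_mem_uIcc Set.right_mem_uIcc
  · calc _ = _ := by congr 1; ring
      _ ≤ _ := this
      _ = _ := by rw [Real.norm_eq_abs, mul_assoc, abs_mul_abs_self, sq (s - t)]
  · have hr0 : 0 ≤ r := (le_min ht hs).trans hr.1
    rw [mul_comm _ z, ← mul_sub, norm_mul]
    calc _ ≤ ‖z‖ * (‖z‖ * |r - t|) := by gcongr; exact norm_cexp_sub_le hz hr0 ht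
      _ ≤ ‖z‖ * (‖z‖ * |s - t|) := by
        gcongr ‖z‖ * (‖z‖ * ?_)
        exact Set.abs_sub_left_of_mem_uIcc hr
      _ = _ := by ring

theorem exists_seminorm_mulExp_sub_le (hh : h.HasTemperateGrowth) (hre : ∀ x, (h x).re ≤ 0)
    {t : ℝ} (ht : 0 ≤ t) (k n : ℕ) (φ : 𝓢(ℝ, ℂ)) :
    ∃ C : ℝ, ∀ s : ℝ, 0 ≤ s → s ≤ t + 1 →
      SchwartzMap.seminorm ℂ k n (mulExp h s φ - mulExp h t φ
        - ((s - t : ℝ) : ℂ) • mulExp h t (SchwartzMap.smulLeftCLM ℂ h φ)) ≤ C * (s - t) ^ 2 := by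
  induction n generalizing φ with
  | zero =>
    refine ⟨SchwartzMap.seminorm ℂ k 0 (SchwartzMap.smulLeftCLM ℂ h (SchwartzMap.smulLeftCLM ℂ h φ)),
      fun s hs _ => seminorm_zero_le (mul_nonneg (apply_nonneg _ _) (sq_nonneg _)) fun x => ?_⟩
    have h1 := SchwartzMap.le_seminorm' ℂ k 0
      (SchwartzMap.smulLeftCLM ℂ h (SchwartzMap.smulLeftCLM ℂ h φ)) x
    rw [iteratedDeriv_zero, smulLeft_apply hh, smulLeft_apply hh, norm_mul, norm_mul] at h1
    have h2 := norm_cexp_sub_sub_le (hre x) hs ht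
    change |x| ^ k * ‖mulExp h s φ x - mulExp h t φ x
      - ((s - t : ℝ) : ℂ) * mulExp h t (SchwartzMap.smulLeftCLM ℂ h φ) x‖ ≤ _
    rw [mulExp_apply hh hre hs, mulExp_apply hh hre ht, mulExp_apply hh hre ht, smulLeft_apply hh]
    calc _ = |x| ^ k * (‖Complex.exp (h x * s) - Complex.exp (h x * t)
          - (s - t) * (h x * Complex.exp (h x * t))‖ * ‖φ x‖) := by
          rw [← norm_mul]; congr 2; push_cast; ring
      _ ≤ |x| ^ k * ((‖h x‖ ^ 2 * (s - t) ^ 2) * ‖φ x‖) := by gcongr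
      _ = |x| ^ k * (‖h x‖ * (‖h x‖ * ‖φ x‖)) * (s - t) ^ 2 := by ring
      _ ≤ _ := by gcongr
  | succ n ih =>
    obtain ⟨C₁, h₁⟩ := ih (SchwartzMap.derivCLM ℂ ℂ φ)
    obtain ⟨C₂, h₂⟩ := ih (SchwartzMap.smulLeftCLM ℂ (deriv h) φ)
    set C₃ := SchwartzMap.seminorm ℂ k n (mulExp h t (SchwartzMap.smulLeftCLM ℂ h
      (SchwartzMap.smulLeftCLM ℂ (deriv h) φ)))
    refine ⟨C₁ + (t + 1) * |C₂| + C₃, fun s hs hst => ?_⟩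
    rw [seminorm_succ]
    have e : SchwartzMap.derivCLM ℂ ℂ (mulExp h s φ - mulExp h t φ
        - ((s - t : ℝ) : ℂ) • mulExp h t (SchwartzMap.smulLeftCLM ℂ h φ)) =
        (mulExp h s (SchwartzMap.derivCLM ℂ ℂ φ) - mulExp h t (SchwartzMap.derivCLM ℂ ℂ φ)
          - ((s - t : ℝ) : ℂ) • mulExp h t (SchwartzMap.smulLeftCLM ℂ h
              (SchwartzMap.derivCLM ℂ ℂ φ)))
        + (s : ℂ) • (mulExp h s (SchwartzMap.smulLeftCLM ℂ (deriv h) φ)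
            - mulExp h t (SchwartzMap.smulLeftCLM ℂ (deriv h) φ)
            - ((s - t : ℝ) : ℂ) • mulExp h t (SchwartzMap.smulLeftCLM ℂ h
                (SchwartzMap.smulLeftCLM ℂ (deriv h) φ)))
        + (((s - t) ^ 2 : ℝ) : ℂ) • mulExp h t (SchwartzMap.smulLeftCLM ℂ h
            (SchwartzMap.smulLeftCLM ℂ (deriv h) φ)) := by
      rw [map_sub, map_sub, map_smul, derivCLM_mulExp hh hre hs, derivCLM_mulExp hh hre ht,
        derivCLM_mulExp hh hre ht, derivCLM_smulLeft hh, smulLeft_comm hh.deriv hh, map_add]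
      push_cast
      module
    rw [e]
    refine (map_add_le_add _ _ _).trans ((add_le_add_left (map_add_le_add _ _ _) _).trans ?_)
    rw [map_smul_eq_mul, map_smul_eq_mul, Complex.norm_real, Complex.norm_real,
      Real.norm_of_nonneg hs, Real.norm_of_nonneg (sq_nonneg _)]
    have h3 := h₁ s hs hst
    have h4 := (h₂ s hs hst).trans
      (mul_le_mul_of_nonneg_right (le_abs_self C₂) (sq_nonneg (s - t)))
    have h5 : s * (|C₂| * (s - t) ^ 2) ≤ (t + 1) * (|C₂| * (s - t) ^ 2) :=
      mul_le_mul_of_nonneg_right hst (by positivity)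
    have h6 := mul_le_mul_of_nonneg_left h4 hs
    linarith

theorem tendsto_slope_mulExp (hh : h.HasTemperateGrowth) (hre : ∀ x, (h x).re ≤ 0)
    {t : ℝ} (ht : 0 ≤ t) (φ : 𝓢(ℝ, ℂ)) :
    Tendsto (slope (fun s => mulExp h s φ) t) (𝓝[Set.Ici 0 \ {t}] t)
      (𝓝 (mulExp h t (SchwartzMap.smulLeftCLM ℂ h φ))) := by
  refine tendsto_schwartz_iff.2 fun k n => ?_
  obtain ⟨C, hC⟩ := exists_seminorm_mulExp_sub_le hh hre ht k n φ
  have h0 : Tendsto (fun s : ℝ => C * |s - t|) (𝓝[Set.Ici 0 \ {t}] t) (𝓝 0) := by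
    have : Continuous fun s : ℝ => C * |s - t| := by fun_prop
    simpa using (this.tendsto t).mono_left nhdsWithin_le_nhds
  refine squeeze_zero' (Eventually.of_forall fun _ => apply_nonneg _ _) ?_ h0
  filter_upwards [self_mem_nhdsWithin,
    mem_nhdsWithin_of_mem_nhds (Iio_mem_nhds (lt_add_one t))] with s hs hs1
  have hst : s - t ≠ 0 := sub_ne_zero.2 hs.2
  have e : slope (fun s => mulExp h s φ) t s - mulExp h t (SchwartzMap.smulLeftCLM ℂ h φ) =
      (((s - t)⁻¹ : ℝ) : ℂ) • (mulExp h s φ - mulExp h t φ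
        - ((s - t : ℝ) : ℂ) • mulExp h t (SchwartzMap.smulLeftCLM ℂ h φ)) := by
    rw [smul_sub, smul_smul, ← Complex.ofReal_mul, inv_mul_cancel₀ hst, Complex.ofReal_one,
      one_smul, slope_def_module]
    rfl
  rw [e, map_smul_eq_mul, Complex.norm_real, norm_inv, Real.norm_eq_abs]
  have h1 := hC s hs.1 (le_of_lt hs1)
  have h2 : 0 < |s - t| := abs_pos.2 hst
  rw [inv_mul_le_iff₀ h2]
  calc _ ≤ _ := h1
    _ = _ := by rw [← sq_abs (s - t)]; ring

theorem exists_pow_mul_seminorm_mulExp_le (hh : h.HasTemperateGrowth) (hre : ∀ x, (h x).re ≤ 0)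
    {K : ℕ} {D : ℝ} (hD : ∀ x, 1 ≤ D * (1 + |x|) ^ K * (-(h x).re)) (M k n : ℕ) (φ : 𝓢(ℝ, ℂ)) :
    ∃ C : ℝ, ∀ s : ℝ, 0 ≤ s → s ^ M * SchwartzMap.seminorm ℂ k n (mulExp h s φ) ≤ C := by
  induction n generalizing φ M with
  | zero =>
    have hD0 : 0 ≤ D := by
      by_contra hcon
      have := hD 0
      have h2 := hre 0
      simp at this
      nlinarith
    set B := 2 ^ (k + K * M) * ((Finset.Iic (k + K * M, 0)).sup
      fun m => SchwartzMap.seminorm ℂ m.1 m.2) φ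
    have hB : 0 ≤ B := mul_nonneg (by positivity) (apply_nonneg _ _)
    refine ⟨M.factorial * D ^ M * B, fun s hs => ?_⟩
    have key : SchwartzMap.seminorm ℂ k 0 ((s ^ M : ℂ) • mulExp h s φ)
        ≤ M.factorial * D ^ M * B := by
      refine seminorm_zero_le (by positivity) fun x => ?_
      have h1 := SchwartzMap.one_add_le_sup_seminorm_apply (𝕜 := ℂ) (m := (k + K * M, 0)) le_rfl
        le_rfl φ x
      rw [norm_iteratedFDeriv_zero, Real.norm_eq_abs] at h1
      have h2 := Real.pow_div_factorial_le_exp (x := -(h x).re * s)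
        (mul_nonneg (neg_nonneg.2 (hre x)) hs) M
      rw [div_le_iff₀ (by positivity)] at h2
      have h3 : s ^ M ≤ (D * (1 + |x|) ^ K) ^ M * (-(h x).re * s) ^ M := by
        rw [← mul_pow]
        refine pow_le_pow_left₀ hs ?_ M
        have := mul_le_mul_of_nonneg_right (hD x) hs
        linarith
      have h4 : s ^ M * Real.exp ((h x).re * s) ≤ (D * (1 + |x|) ^ K) ^ M * M.factorial := by
        have h5 : Real.exp (-(h x).re * s) * Real.exp ((h x).re * s) = 1 := by
          rw [← Real.exp_add]; simp
        calc _ ≤ ((D * (1 + |x|) ^ K) ^ M * (-(h x).re * s) ^ M) * Real.exp ((h x).re * s) := by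
              gcongr
          _ ≤ ((D * (1 + |x|) ^ K) ^ M * (Real.exp (-(h x).re * s) * M.factorial))
                * Real.exp ((h x).re * s) := by gcongr
          _ = (D * (1 + |x|) ^ K) ^ M * M.factorial
                * (Real.exp (-(h x).re * s) * Real.exp ((h x).re * s)) := by ring
          _ = _ := by rw [h5, mul_one]
      change |x| ^ k * ‖(s ^ M : ℂ) * mulExp h s φ x‖ ≤ _
      rw [mulExp_apply hh hre hs, norm_mul, norm_mul, norm_pow, Complex.norm_real,
        Real.norm_of_nonneg hs, Complex.norm_exp]
      have h6 : (h x * s).re = (h x).re * s := by simp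
      rw [h6]
      calc |x| ^ k * (s ^ M * (Real.exp ((h x).re * s) * ‖φ x‖))
          = |x| ^ k * (s ^ M * Real.exp ((h x).re * s)) * ‖φ x‖ := by ring
        _ ≤ (1 + |x|) ^ k * ((D * (1 + |x|) ^ K) ^ M * M.factorial) * ‖φ x‖ := by
            gcongr; linarith [abs_nonneg x]
        _ = M.factorial * D ^ M * ((1 + |x|) ^ (k + K * M) * ‖φ x‖) := by ring
        _ ≤ _ := by gcongr
    rwa [map_smul_eq_mul, norm_pow, Complex.norm_real, Real.norm_of_nonneg hs] at key
  | succ n ih =>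
    obtain ⟨C₁, h₁⟩ := ih M (SchwartzMap.derivCLM ℂ ℂ φ)
    obtain ⟨C₂, h₂⟩ := ih (M + 1) (SchwartzMap.smulLeftCLM ℂ (deriv h) φ)
    refine ⟨C₁ + C₂, fun s hs => ?_⟩
    rw [seminorm_succ, derivCLM_mulExp hh hre hs]
    have h3 := map_add_le_add (SchwartzMap.seminorm ℂ k n)
      (mulExp h s (SchwartzMap.derivCLM ℂ ℂ φ))
      ((s : ℂ) • mulExp h s (SchwartzMap.smulLeftCLM ℂ (deriv h) φ))
    rw [map_smul_eq_mul, Complex.norm_real, Real.norm_of_nonneg hs] at h3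
    have h4 := mul_le_mul_of_nonneg_left h3 (pow_nonneg hs M)
    have h5 := h₂ s hs
    rw [pow_succ] at h5
    linarith [h₁ s hs]

/-- If `Re h` is negative, with a polynomial lower bound, then `exp (h s) φ` decays faster than
all powers of `s` in the Schwartz space. -/
theorem tendsto_pow_mul_mulExp (hh : h.HasTemperateGrowth) (hre : ∀ x, (h x).re ≤ 0)
    {K : ℕ} {D : ℝ} (hD : ∀ x, 1 ≤ D * (1 + |x|) ^ K * (-(h x).re)) (N : ℕ) (φ : 𝓢(ℝ, ℂ)) :
    Tendsto (fun s : ℝ => ((1 + s : ℝ) ^ N : ℂ) • mulExp h s φ) atTop (𝓝 0) := by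
  refine tendsto_schwartz_iff.2 fun k n => ?_
  obtain ⟨C, hC⟩ := exists_pow_mul_seminorm_mulExp_le hh hre hD (N + 1) k n φ
  have h0 : Tendsto (fun s : ℝ => 2 ^ N * C * s⁻¹) atTop (𝓝 0) := by
    simpa using tendsto_inv_atTop_zero.const_mul (2 ^ N * C)
  refine squeeze_zero' (Eventually.of_forall fun _ => apply_nonneg _ _) ?_ h0
  filter_upwards [eventually_ge_atTop 1] with s hs
  have hs0 : 0 < s := by linarith
  rw [sub_zero, map_smul_eq_mul, norm_pow, Complex.norm_real, Real.norm_of_nonneg (by linarith),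
    ← div_eq_mul_inv, le_div_iff₀ hs0]
  calc (1 + s) ^ N * SchwartzMap.seminorm ℂ k n (mulExp h s φ) * s
      ≤ (2 * s) ^ N * SchwartzMap.seminorm ℂ k n (mulExp h s φ) * s := by
        gcongr; linarith
    _ = 2 ^ N * (s ^ (N + 1) * SchwartzMap.seminorm ℂ k n (mulExp h s φ)) := by ring
    _ ≤ _ := by gcongr; exact hC s hs0.le

end MulExp

/-! ### Curves of functionals applied to curves of Schwartz functions -/

theorem hasDerivWithinAt_apply_curve {T : ℝ → 𝓢(ℝ, ℂ) →ₗ[ℂ] ℂ} {c : ℝ → 𝓢(ℝ, ℂ)}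
    {c' : 𝓢(ℝ, ℂ)} {S : Set ℝ} {t : ℝ} {d : ℂ} {q : Seminorm ℂ 𝓢(ℝ, ℂ)} (hq : Continuous q)
    (hT : ∀ᶠ s in 𝓝[S] t, ∀ φ, ‖T s φ‖ ≤ q φ)
    (hTc : Tendsto (fun s => T s c') (𝓝[S] t) (𝓝 (T t c')))
    (hTd : HasDerivWithinAt (fun s => T s (c t)) d S t)
    (hc : Tendsto (slope c t) (𝓝[S \ {t}] t) (𝓝 c')) :
    HasDerivWithinAt (fun s => T s (c s)) (d + T t c') S t := by
  rw [hasDerivWithinAt_iff_tendsto_slope] at hTd ⊢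
  have hle : 𝓝[S \ {t}] t ≤ 𝓝[S] t := nhdsWithin_mono _ Set.sdiff_subset
  have h1 : Tendsto (fun s => T s (slope c t s)) (𝓝[S \ {t}] t) (𝓝 (T t c')) := by
    have h2 : Tendsto (fun s => T s (slope c t s - c')) (𝓝[S \ {t}] t) (𝓝 0) := by
      have h3 : Tendsto (fun s => q (slope c t s - c')) (𝓝[S \ {t}] t) (𝓝 0) := by
        have := (hq.tendsto _).comp (hc.sub_const c')
        simpa [Function.comp_def] using this
      refine squeeze_zero_norm' ?_ h3
      filter_upwards [hle hT] with s hs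
      exact hs _
    have h4 := h2.add (hTc.mono_left hle)
    simpa using h4
  refine (hTd.add h1).congr fun s => ?_
  rw [slope_def_module, slope_def_module, slope_def_module, ← Complex.coe_smul (s - t)⁻¹ (c s - c t),
    map_smul, Complex.coe_smul, ← smul_add, map_sub]
  congr 1
  ring

/-! ### Density of the compactly supported functions -/

theorem seminorm_dilate_sub_le (τ φ : 𝓢(ℝ, ℂ)) (k n : ℕ) :
    ∃ C : ℝ, ∀ r : ℝ, 0 ≤ r → r ≤ 1 →
      SchwartzMap.seminorm ℂ k n (SchwartzMap.smulLeftCLM ℂ (fun x => τ (r * x)) φ - τ 0 • φ)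
        ≤ C * r := by
  have hτ : ∀ (τ : 𝓢(ℝ, ℂ)) (r : ℝ), (fun x => τ (r * x)).HasTemperateGrowth := fun τ r =>
    τ.hasTemperateGrowth.comp (r • ContinuousLinearMap.id ℝ ℝ).hasTemperateGrowth
  induction n generalizing τ φ with
  | zero =>
    set L := SchwartzMap.seminorm ℂ 0 0 (SchwartzMap.derivCLM ℂ ℂ τ)
    refine ⟨L * SchwartzMap.seminorm ℂ (k + 1) 0 φ, fun r hr _ => ?_⟩
    refine seminorm_zero_le (mul_nonneg (mul_nonneg (apply_nonneg _ _) (apply_nonneg _ _)) hr)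
      fun x => ?_
    have h1 : ‖τ (r * x) - τ 0‖ ≤ L * |r * x - 0| :=
      convex_univ.norm_image_sub_le_of_norm_hasDerivWithin_le
        (fun y _ => (τ.hasDerivAt y).hasDerivWithinAt)
        (fun y _ => SchwartzMap.norm_le_seminorm ℂ (SchwartzMap.derivCLM ℂ ℂ τ) y)
        (Set.mem_univ _) (Set.mem_univ _)
    have h2 := SchwartzMap.le_seminorm' ℂ (k + 1) 0 φ x
    rw [iteratedDeriv_zero] at h2
    rw [sub_zero, abs_mul, abs_of_nonneg hr] at h1
    change |x| ^ k * ‖SchwartzMap.smulLeftCLM ℂ (fun x => τ (r * x)) φ x - τ 0 * φ x‖ ≤ _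
    rw [smulLeft_apply (hτ τ r), ← sub_mul, norm_mul]
    calc |x| ^ k * (‖τ (r * x) - τ 0‖ * ‖φ x‖) ≤ |x| ^ k * (L * (r * |x|) * ‖φ x‖) := by gcongr
      _ = L * (|x| ^ (k + 1) * ‖φ x‖) * r := by ring
      _ ≤ _ := by gcongr
  | succ n ih =>
    obtain ⟨C₁, h₁⟩ := ih τ (SchwartzMap.derivCLM ℂ ℂ φ)
    obtain ⟨C₂, h₂⟩ := ih (SchwartzMap.derivCLM ℂ ℂ τ) φ
    set τ' := SchwartzMap.derivCLM ℂ ℂ τ with hτ'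
    refine ⟨C₁ + (|C₂| + ‖τ' 0‖ * SchwartzMap.seminorm ℂ k n φ), fun r hr hr1 => ?_⟩
    have e : SchwartzMap.derivCLM ℂ ℂ (SchwartzMap.smulLeftCLM ℂ (fun x => τ (r * x)) φ - τ 0 • φ) =
        (SchwartzMap.smulLeftCLM ℂ (fun x => τ (r * x)) (SchwartzMap.derivCLM ℂ ℂ φ)
          - τ 0 • SchwartzMap.derivCLM ℂ ℂ φ)
        + (r : ℂ) • ((SchwartzMap.smulLeftCLM ℂ (fun x => τ' (r * x)) φ - τ' 0 • φ)
          + τ' 0 • φ) := by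
      have h3 : SchwartzMap.smulLeftCLM ℂ (deriv fun x => τ (r * x)) φ =
          (r : ℂ) • SchwartzMap.smulLeftCLM ℂ (fun x => τ' (r * x)) φ := by
        ext x
        rw [smulLeft_apply (hτ τ r).deriv]
        change _ = (r : ℂ) * SchwartzMap.smulLeftCLM ℂ (fun x => τ' (r * x)) φ x
        rw [smulLeft_apply (hτ τ' r), ← mul_assoc]
        congr 1
        have := (τ.hasDerivAt (r * x)).scomp x ((hasDerivAt_id x).const_mul r)
        rw [mul_one] at this
        exact this.deriv
      rw [map_sub, map_smul, derivCLM_smulLeft (hτ τ r), h3]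
      module
    rw [seminorm_succ, e]
    refine (map_add_le_add _ _ _).trans ?_
    rw [map_smul_eq_mul, Complex.norm_real, Real.norm_of_nonneg hr]
    have h4 := map_add_le_add (SchwartzMap.seminorm ℂ k n)
      (SchwartzMap.smulLeftCLM ℂ (fun x => τ' (r * x)) φ - τ' 0 • φ) (τ' 0 • φ)
    rw [map_smul_eq_mul] at h4
    have h5 : C₂ * r ≤ |C₂| * 1 :=
      mul_le_mul (le_abs_self _) hr1 hr (abs_nonneg _)
    have h6 := h₂ r hr hr1
    have h7 : r * (SchwartzMap.seminorm ℂ k n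
        ((SchwartzMap.smulLeftCLM ℂ (fun x => τ' (r * x)) φ - τ' 0 • φ) + τ' 0 • φ))
        ≤ r * (|C₂| + ‖τ' 0‖ * SchwartzMap.seminorm ℂ k n φ) := by
      gcongr
      linarith
    linarith [h₁ r hr hr1]

theorem exists_seq_hasCompactSupport_tendsto (φ : 𝓢(ℝ, ℂ)) :
    ∃ f : ℕ → 𝓢(ℝ, ℂ), (∀ j, HasCompactSupport (f j)) ∧ Tendsto f atTop (𝓝 φ) := by
  let b : ContDiffBump (0 : ℝ) := ⟨1, 2, one_pos, one_lt_two⟩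
  have hb : HasCompactSupport fun x => ((b x : ℝ) : ℂ) :=
    b.hasCompactSupport.comp_left Complex.ofReal_zero
  let τ : 𝓢(ℝ, ℂ) := hb.toSchwartzMap (Complex.ofRealCLM.contDiff.comp b.contDiff)
  have hτ0 : τ 0 = 1 := by
    change ((b 0 : ℝ) : ℂ) = 1
    rw [b.one_of_mem_closedBall (by simp [b]), Complex.ofReal_one]
  let r : ℕ → ℝ := fun j => 1 / (j + 1 : ℝ)
  have hr : ∀ j, 0 < r j := fun j => by positivity
  have hr1 : ∀ j, r j ≤ 1 := fun j => by
    rw [div_le_one (by positivity)]; simp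
  refine ⟨fun j => SchwartzMap.smulLeftCLM ℂ (fun x => τ (r j * x)) φ, fun j => ?_, ?_⟩
  · have h1 : HasCompactSupport fun x => τ (r j * x) :=
      (show HasCompactSupport τ from hb).comp_homeomorph (Homeomorph.mulLeft₀ (r j) (hr j).ne')
    have e : ⇑(SchwartzMap.smulLeftCLM ℂ (fun x => τ (r j * x)) φ) =
        fun x => τ (r j * x) * φ x := funext (smulLeft_apply (τ.hasTemperateGrowth.comp
          (r j • ContinuousLinearMap.id ℝ ℝ).hasTemperateGrowth) φ)
    rw [e]
    exact h1.mul_right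
  · refine tendsto_schwartz_iff.2 fun k n => ?_
    obtain ⟨C, hC⟩ := seminorm_dilate_sub_le τ φ k n
    have h0 : Tendsto (fun j => C * r j) atTop (𝓝 0) := by
      simpa [r] using tendsto_one_div_add_atTop_nhds_zero_nat.const_mul C
    refine squeeze_zero (fun _ => apply_nonneg _ _) (fun j => ?_) h0
    have := hC (r j) (hr j).le (hr1 j)
    rwa [hτ0, one_smul] at this

theorem eq_of_eq_on_hasCompactSupport {F G : 𝓢(ℝ, ℂ) → ℂ} (hF : Continuous F) (hG : Continuous G)
    (h : ∀ φ : 𝓢(ℝ, ℂ), HasCompactSupport φ → F φ = G φ) (φ : 𝓢(ℝ, ℂ)) : F φ = G φ := by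
  obtain ⟨f, hf, hlim⟩ := exists_seq_hasCompactSupport_tendsto φ
  refine tendsto_nhds_unique ((hF.tendsto φ).comp hlim) ?_
  refine ((hG.tendsto φ).comp hlim).congr fun j => ?_
  exact (h _ (hf j)).symm

/-! ### Slices of Schwartz functions on the plane -/

theorem lineDerivOp_comm (a b : ℝ × ℝ) (Φ : 𝓢(ℝ × ℝ, ℂ)) :
    ∂_{a} (∂_{b} Φ) = ∂_{b} (∂_{a} Φ) := by
  ext p
  have h1 : ∀ y, HasFDerivAt Φ (fderiv ℝ Φ y) y := Φ.hasFDerivAt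
  have h2 : HasFDerivAt (fderiv ℝ Φ) (fderiv ℝ (fderiv ℝ Φ) p) p :=
    (SchwartzMap.fderivCLM ℂ (ℝ × ℝ) ℂ Φ).hasFDerivAt p
  have h3 : ∀ a b : ℝ × ℝ, (∂_{a} (∂_{b} Φ)) p = fderiv ℝ (fderiv ℝ Φ) p a b := by
    intro a b
    rw [SchwartzMap.lineDerivOp_apply_eq_fderiv]
    have e : ⇑(∂_{b} Φ : 𝓢(ℝ × ℝ, ℂ)) = fun y => fderiv ℝ Φ y b :=
      funext fun y => SchwartzMap.lineDerivOp_apply_eq_fderiv b Φ y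
    have h4 : HasFDerivAt (fun y => fderiv ℝ Φ y b) _ p :=
      (ContinuousLinearMap.apply ℝ ℂ b).hasFDerivAt.comp p h2
    rw [e, h4.fderiv]
    rfl
  rw [h3, h3]
  exact second_derivative_symmetric h1 h2 a b

theorem hasDerivAt_slice_left (Φ : 𝓢(ℝ × ℝ, ℂ)) (x y : ℝ) :
    HasDerivAt (fun x => Φ (x, y)) ((∂_{((1 : ℝ), (0 : ℝ))} Φ) (x, y)) x := by
  rw [SchwartzMap.lineDerivOp_apply_eq_fderiv]
  exact (Φ.hasFDerivAt (x, y)).comp_hasDerivAt x ((hasDerivAt_id x).prodMk (hasDerivAt_const x y))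

theorem hasDerivAt_slice_right (Φ : 𝓢(ℝ × ℝ, ℂ)) (x y : ℝ) :
    HasDerivAt (fun y => Φ (x, y)) ((∂_{((0 : ℝ), (1 : ℝ))} Φ) (x, y)) y := by
  rw [SchwartzMap.lineDerivOp_apply_eq_fderiv]
  exact (Φ.hasFDerivAt (x, y)).comp_hasDerivAt y ((hasDerivAt_const y x).prodMk (hasDerivAt_id y))

theorem derivCLM_slice (x : ℝ) (Φ : 𝓢(ℝ × ℝ, ℂ)) :
    SchwartzMap.derivCLM ℂ ℂ (slice x Φ) = slice x (∂_{((0 : ℝ), (1 : ℝ))} Φ) := by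
  ext y
  rw [SchwartzMap.derivCLM_apply]
  exact (hasDerivAt_slice_right Φ x y).deriv

theorem continuous_seminorm_plane (k n : ℕ) :
    Continuous (SchwartzMap.seminorm ℂ k n : Seminorm ℂ 𝓢(ℝ × ℝ, ℂ)) :=
  (schwartz_withSeminorms ℂ (ℝ × ℝ) ℂ).continuous_seminorm (k, n)

theorem norm_pow_mul_slice_le (Φ : 𝓢(ℝ × ℝ, ℂ)) (k : ℕ) (x y : ℝ) :
    |y| ^ k * ‖Φ (x, y)‖ ≤ SchwartzMap.seminorm ℂ k 0 Φ := by
  refine le_trans ?_ (SchwartzMap.norm_pow_mul_le_seminorm ℂ Φ k (x, y))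
  gcongr
  exact le_max_right |x| |y|

theorem exists_seminorm_slice_le (k n : ℕ) :
    ∃ q : Seminorm ℂ 𝓢(ℝ × ℝ, ℂ), Continuous q ∧
      ∀ x Φ, SchwartzMap.seminorm ℂ k n (slice x Φ) ≤ q Φ := by
  induction n with
  | zero =>
    exact ⟨SchwartzMap.seminorm ℂ k 0, continuous_seminorm_plane k 0, fun x Φ =>
      seminorm_zero_le (apply_nonneg _ _) fun y => norm_pow_mul_slice_le Φ k x y⟩
  | succ n ih =>
    obtain ⟨q, hq, hb⟩ := ih
    refine ⟨q.comp (LineDeriv.lineDerivOpCLM ℂ 𝓢(ℝ × ℝ, ℂ) ((0 : ℝ), (1 : ℝ))).toLinearMap,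
      hq.comp (LineDeriv.lineDerivOpCLM ℂ 𝓢(ℝ × ℝ, ℂ) ((0 : ℝ), (1 : ℝ))).continuous, fun x Φ => ?_⟩
    rw [seminorm_succ, derivCLM_slice]
    exact hb x _

/-- A continuous seminorm on a Schwartz space is bounded by a sum of the standard ones. -/
theorem exists_seminorm_le_sum {E : Type*} [NormedAddCommGroup E] [NormedSpace ℝ E]
    {p : Seminorm ℂ 𝓢(E, ℂ)} (hp : Continuous p) :
    ∃ (S : Finset (ℕ × ℕ)) (C : ℝ), 0 ≤ C ∧
      ∀ f, p f ≤ C * ∑ i ∈ S, SchwartzMap.seminorm ℂ i.1 i.2 f := by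
  obtain ⟨S, C, -, hpC⟩ := Seminorm.bound_of_continuous (schwartz_withSeminorms ℂ E ℂ) p hp
  refine ⟨S, C, C.2, fun f => (hpC f).trans ?_⟩
  have := Seminorm.finset_sup_le_sum (schwartzSeminormFamily ℂ E ℂ) S f
  refine mul_le_mul_of_nonneg_left (this.trans ?_) C.2
  simp [schwartzSeminormFamily]

theorem exists_seminorm_of_sum {E : Type*} [AddCommGroup E] [Module ℂ E] [TopologicalSpace E]
    (S : Finset (ℕ × ℕ)) {C : ℝ} (hC : 0 ≤ C) (q : ℕ × ℕ → Seminorm ℂ E)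
    (hq : ∀ i, Continuous (q i)) :
    ∃ Q : Seminorm ℂ E, Continuous Q ∧ ∀ f, Q f = C * ∑ i ∈ S, q i f := by
  have h : ∀ f, (C.toNNReal • ∑ i ∈ S, q i) f = C * ∑ i ∈ S, q i f := fun f => by
    simp [NNReal.smul_def, Real.coe_toNNReal C hC]
  refine ⟨C.toNNReal • ∑ i ∈ S, q i, ?_, h⟩
  have : Continuous fun f => C * ∑ i ∈ S, q i f :=
    continuous_const.mul (continuous_finsetSum _ fun i _ => hq i)
  exact this.congr fun f => (h f).symm

theorem exists_seminorm_eq_mul {E : Type*} [AddCommGroup E] [Module ℂ E] [TopologicalSpace E]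
    {q : Seminorm ℂ E} (hq : Continuous q) {C : ℝ} (hC : 0 ≤ C) :
    ∃ Q : Seminorm ℂ E, Continuous Q ∧ ∀ ψ, Q ψ = C * q ψ := by
  obtain ⟨Q, h1, h2⟩ := exists_seminorm_of_sum {(0, 0)} hC (fun _ => q) fun _ => hq
  exact ⟨Q, h1, fun ψ => by simpa using h2 ψ⟩

theorem exists_seminorm_comp_slice_le {p : Seminorm ℂ 𝓢(ℝ, ℂ)} (hp : Continuous p) :
    ∃ q : Seminorm ℂ 𝓢(ℝ × ℝ, ℂ), Continuous q ∧ ∀ x Φ, p (slice x Φ) ≤ q Φ := by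
  obtain ⟨S, C, hC, hpC⟩ := exists_seminorm_le_sum hp
  choose Q hQ hb using fun kn : ℕ × ℕ => exists_seminorm_slice_le kn.1 kn.2
  obtain ⟨q, hq, e⟩ := exists_seminorm_of_sum S hC Q hQ
  refine ⟨q, hq, fun x Φ => (hpC _).trans ?_⟩
  rw [e]
  gcongr with i
  exact hb i x Φ

theorem hasTemperateGrowth_one_add_sq_fst (N : ℕ) :
    (fun p : ℝ × ℝ => ((1 + p.1 ^ 2 : ℝ) : ℂ) ^ N).HasTemperateGrowth := by
  have h : (fun p : ℝ × ℝ => (p.1 : ℂ)).HasTemperateGrowth :=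
    Function.Complex.hasTemperateGrowth_ofReal.comp (ContinuousLinearMap.fst ℝ ℝ ℝ).hasTemperateGrowth
  have h2 := ((Function.HasTemperateGrowth.const (1 : ℂ)).add (h.pow 2)).pow N
  have e : (fun p : ℝ × ℝ => ((1 + p.1 ^ 2 : ℝ) : ℂ) ^ N) =
      ((fun _ => 1) + (fun p => (p.1 : ℂ)) ^ 2) ^ N := by
    funext p
    simp
  rw [e]
  exact h2

/-- Slices of a Schwartz function decay rapidly in the transversal variable. -/
theorem exists_seminorm_pow_mul_slice_le {p : Seminorm ℂ 𝓢(ℝ, ℂ)} (hp : Continuous p) (N : ℕ) :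
    ∃ q : Seminorm ℂ 𝓢(ℝ × ℝ, ℂ), Continuous q ∧
      ∀ x Φ, (1 + x ^ 2) ^ N * p (slice x Φ) ≤ q Φ := by
  obtain ⟨q, hq, hb⟩ := exists_seminorm_comp_slice_le hp
  have hw := hasTemperateGrowth_one_add_sq_fst N
  set W := SchwartzMap.smulLeftCLM (F := ℂ) (fun p : ℝ × ℝ => ((1 + p.1 ^ 2 : ℝ) : ℂ) ^ N)
  refine ⟨q.comp W.toLinearMap, hq.comp W.continuous, fun x Φ => ?_⟩
  have e : slice x (W Φ) = (((1 + x ^ 2 : ℝ) : ℂ) ^ N) • slice x Φ := by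
    ext y
    exact SchwartzMap.smulLeftCLM_apply_apply hw Φ (x, y)
  have := hb x (W Φ)
  rw [e, map_smul_eq_mul, norm_pow, Complex.norm_real, Real.norm_of_nonneg (by positivity)] at this
  exact this

theorem norm_sub_sub_smul_le {f f' f'' : ℝ → ℂ} (h : ∀ x, HasDerivAt f (f' x) x)
    (h' : ∀ x, HasDerivAt f' (f'' x) x) {C : ℝ} (hC : ∀ x, ‖f'' x‖ ≤ C) (x t : ℝ) :
    ‖f x - f t - (x - t) * f' t‖ ≤ C * (x - t) ^ 2 := by
  have h1 : ∀ r, ‖f' r - f' t‖ ≤ C * |r - t| := fun r =>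
    convex_univ.norm_image_sub_le_of_norm_hasDerivWithin_le (fun y _ => (h' y).hasDerivWithinAt)
      (fun y _ => hC y) (Set.mem_univ _) (Set.mem_univ _)
  have hd : ∀ r : ℝ, HasDerivAt (fun r : ℝ => f r - r * f' t) (f' r - f' t) r := fun r => by
    refine ((h r).sub ((Complex.ofRealCLM.hasDerivAt (x := r)).mul_const (f' t))).congr_deriv ?_
    simp
  have hC0 : 0 ≤ C := (norm_nonneg _).trans (hC 0)
  have := (convex_uIcc t x).norm_image_sub_le_of_norm_hasDerivWithin_le
    (C := C * |x - t|) (fun r _ => (hd r).hasDerivWithinAt) (fun r hr => (h1 r).trans (by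
      gcongr C * ?_
      exact Set.abs_sub_left_of_mem_uIcc hr)) Set.left_mem_uIcc Set.right_mem_uIcc
  calc _ = _ := by congr 1; ring
    _ ≤ _ := this
    _ = _ := by rw [Real.norm_eq_abs, mul_assoc, abs_mul_abs_self, sq (x - t)]

theorem exists_seminorm_slice_sub_le (t : ℝ) (k n : ℕ) (Φ : 𝓢(ℝ × ℝ, ℂ)) :
    ∃ C : ℝ, ∀ x, SchwartzMap.seminorm ℂ k n (slice x Φ - slice t Φ
      - ((x - t : ℝ) : ℂ) • slice t (∂_{((1 : ℝ), (0 : ℝ))} Φ)) ≤ C * (x - t) ^ 2 := by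
  induction n generalizing Φ with
  | zero =>
    set Φ₁ := ∂_{((1 : ℝ), (0 : ℝ))} Φ
    set Φ₂ := ∂_{((1 : ℝ), (0 : ℝ))} Φ₁
    refine ⟨SchwartzMap.seminorm ℂ k 0 Φ₂, fun x =>
      seminorm_zero_le (mul_nonneg (apply_nonneg _ _) (sq_nonneg _)) fun y => ?_⟩
    change |y| ^ k * ‖Φ (x, y) - Φ (t, y) - ((x - t : ℝ) : ℂ) * Φ₁ (t, y)‖ ≤ _
    have h1 := norm_sub_sub_smul_le (f := fun x => (|y| ^ k : ℂ) * Φ (x, y))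
      (fun x => (hasDerivAt_slice_left Φ x y).const_mul (|y| ^ k : ℂ))
      (fun x => (hasDerivAt_slice_left Φ₁ x y).const_mul (|y| ^ k : ℂ))
      (C := SchwartzMap.seminorm ℂ k 0 Φ₂) (fun x => by
        have := norm_pow_mul_slice_le Φ₂ k x y
        simpa using this) x t
    have h2 : |y| ^ k * ‖Φ (x, y) - Φ (t, y) - ((x - t : ℝ) : ℂ) * Φ₁ (t, y)‖ =
        ‖(|y| ^ k : ℂ) * (Φ (x, y) - Φ (t, y) - ((x - t : ℝ) : ℂ) * Φ₁ (t, y))‖ := by simp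
    rw [h2]
    refine le_trans (le_of_eq ?_) h1
    congr 1
    push_cast
    ring
  | succ n ih =>
    obtain ⟨C, hC⟩ := ih (∂_{((0 : ℝ), (1 : ℝ))} Φ)
    refine ⟨C, fun x => ?_⟩
    have e : SchwartzMap.derivCLM ℂ ℂ (slice x Φ - slice t Φ
        - ((x - t : ℝ) : ℂ) • slice t (∂_{((1 : ℝ), (0 : ℝ))} Φ)) =
        slice x (∂_{((0 : ℝ), (1 : ℝ))} Φ) - slice t (∂_{((0 : ℝ), (1 : ℝ))} Φ)
        - ((x - t : ℝ) : ℂ) • slice t (∂_{((1 : ℝ), (0 : ℝ))} (∂_{((0 : ℝ), (1 : ℝ))} Φ)) := by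
      rw [map_sub, map_sub, map_smul, derivCLM_slice, derivCLM_slice, derivCLM_slice,
        lineDerivOp_comm]
    rw [seminorm_succ, e]
    exact hC x

theorem tendsto_slope_slice (t : ℝ) (Φ : 𝓢(ℝ × ℝ, ℂ)) (S : Set ℝ) :
    Tendsto (slope (fun x => slice x Φ) t) (𝓝[S \ {t}] t)
      (𝓝 (slice t (∂_{((1 : ℝ), (0 : ℝ))} Φ))) := by
  refine tendsto_schwartz_iff.2 fun k n => ?_
  obtain ⟨C, hC⟩ := exists_seminorm_slice_sub_le t k n Φ
  have h0 : Tendsto (fun x : ℝ => C * |x - t|) (𝓝[S \ {t}] t) (𝓝 0) := by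
    have : Continuous fun x : ℝ => C * |x - t| := by fun_prop
    simpa using (this.tendsto t).mono_left nhdsWithin_le_nhds
  refine squeeze_zero' (Eventually.of_forall fun _ => apply_nonneg _ _) ?_ h0
  filter_upwards [self_mem_nhdsWithin] with x hx
  have hxt : x - t ≠ 0 := sub_ne_zero.2 hx.2
  have e : slope (fun x => slice x Φ) t x - slice t (∂_{((1 : ℝ), (0 : ℝ))} Φ) =
      (((x - t)⁻¹ : ℝ) : ℂ) • (slice x Φ - slice t Φ
        - ((x - t : ℝ) : ℂ) • slice t (∂_{((1 : ℝ), (0 : ℝ))} Φ)) := by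
    rw [smul_sub, smul_smul, ← Complex.ofReal_mul, inv_mul_cancel₀ hxt, Complex.ofReal_one,
      one_smul, slope_def_module]
    rfl
  rw [e, map_smul_eq_mul, Complex.norm_real, norm_inv, Real.norm_eq_abs]
  have h2 : 0 < |x - t| := abs_pos.2 hxt
  rw [inv_mul_le_iff₀ h2]
  calc _ ≤ _ := hC x
    _ = _ := by rw [← sq_abs (x - t)]; ring

/-! ### Tensor products of Schwartz functions -/

theorem norm_iteratedFDeriv_comp_le_of_norm_le_one (L : ℝ × ℝ →L[ℝ] ℝ) (hL : ‖L‖ ≤ 1)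
    (f : 𝓢(ℝ, ℂ)) (i : ℕ) (p : ℝ × ℝ) :
    ‖iteratedFDeriv ℝ i (fun p => f (L p)) p‖ ≤ ‖iteratedFDeriv ℝ i f (L p)‖ := by
  have := L.iteratedFDeriv_comp_right (f.smooth ⊤) p (i := i) (mod_cast le_top)
  change ‖iteratedFDeriv ℝ i (f ∘ L) p‖ ≤ _
  rw [this]
  refine (ContinuousMultilinearMap.norm_compContinuousLinearMap_le _ _).trans ?_
  refine mul_le_of_le_one_right (norm_nonneg _) ?_
  simpa using pow_le_one₀ (norm_nonneg _) hL

theorem norm_pow_mul_iteratedFDeriv_tensor_le (χ ψ : 𝓢(ℝ, ℂ)) (k n : ℕ) (p : ℝ × ℝ) :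
    ‖p‖ ^ k * ‖iteratedFDeriv ℝ n (fun p : ℝ × ℝ => χ p.1 * ψ p.2) p‖ ≤
      2 ^ (n + 2 * k)
        * (Finset.Iic (k, n)).sup (fun m => SchwartzMap.seminorm ℂ m.1 m.2) χ
        * (Finset.Iic (k, n)).sup (fun m => SchwartzMap.seminorm ℂ m.1 m.2) ψ := by
  set A := (Finset.Iic (k, n)).sup (fun m => SchwartzMap.seminorm ℂ m.1 m.2) χ
  set B := (Finset.Iic (k, n)).sup (fun m => SchwartzMap.seminorm ℂ m.1 m.2) ψ
  have h1 := norm_iteratedFDeriv_mul_le (𝕜 := ℝ) (N := n) (f := fun p : ℝ × ℝ => χ p.1)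
    (g := fun p : ℝ × ℝ => ψ p.2) ((χ.smooth n).comp contDiff_fst) ((ψ.smooth n).comp contDiff_snd)
    p le_rfl
  have hp : ‖p‖ ^ k ≤ (1 + ‖p.1‖) ^ k * (1 + ‖p.2‖) ^ k := by
    rw [← mul_pow]
    gcongr
    refine max_le ?_ ?_ <;> nlinarith [norm_nonneg p.1, norm_nonneg p.2]
  have hA : ∀ i ≤ n, (1 + ‖p.1‖) ^ k * ‖iteratedFDeriv ℝ i (fun p : ℝ × ℝ => χ p.1) p‖
      ≤ 2 ^ k * A := fun i hi =>
    (mul_le_mul_of_nonneg_left (norm_iteratedFDeriv_comp_le_of_norm_le_one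
      (ContinuousLinearMap.fst ℝ ℝ ℝ) (ContinuousLinearMap.norm_fst_le ..) χ i p)
      (by positivity)).trans
      (SchwartzMap.one_add_le_sup_seminorm_apply (𝕜 := ℂ) (m := (k, n)) le_rfl hi χ p.1)
  have hB : ∀ i ≤ n, (1 + ‖p.2‖) ^ k * ‖iteratedFDeriv ℝ i (fun p : ℝ × ℝ => ψ p.2) p‖
      ≤ 2 ^ k * B := fun i hi =>
    (mul_le_mul_of_nonneg_left (norm_iteratedFDeriv_comp_le_of_norm_le_one
      (ContinuousLinearMap.snd ℝ ℝ ℝ) (ContinuousLinearMap.norm_snd_le ..) ψ i p)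
      (by positivity)).trans
      (SchwartzMap.one_add_le_sup_seminorm_apply (𝕜 := ℂ) (m := (k, n)) le_rfl hi ψ p.2)
  have hA0 : 0 ≤ A := apply_nonneg _ _
  have hB0 : 0 ≤ B := apply_nonneg _ _
  calc _ ≤ ((1 + ‖p.1‖) ^ k * (1 + ‖p.2‖) ^ k) * ∑ i ∈ Finset.range (n + 1), (n.choose i : ℝ)
        * ‖iteratedFDeriv ℝ i (fun p : ℝ × ℝ => χ p.1) p‖
        * ‖iteratedFDeriv ℝ (n - i) (fun p : ℝ × ℝ => ψ p.2) p‖ := by gcongr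
    _ = ∑ i ∈ Finset.range (n + 1), (n.choose i : ℝ)
        * (((1 + ‖p.1‖) ^ k * ‖iteratedFDeriv ℝ i (fun p : ℝ × ℝ => χ p.1) p‖)
        * ((1 + ‖p.2‖) ^ k * ‖iteratedFDeriv ℝ (n - i) (fun p : ℝ × ℝ => ψ p.2) p‖)) := by
      rw [Finset.mul_sum]
      exact Finset.sum_congr rfl fun i _ => by ring
    _ ≤ ∑ i ∈ Finset.range (n + 1), (n.choose i : ℝ) * ((2 ^ k * A) * (2 ^ k * B)) := by
      refine Finset.sum_le_sum fun i hi => mul_le_mul_of_nonneg_left ?_ (Nat.cast_nonneg _)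
      exact mul_le_mul (hA i (Nat.lt_succ_iff.1 (Finset.mem_range.1 hi))) (hB _ (Nat.sub_le _ _))
        (by positivity) (by positivity)
    _ = _ := by
      rw [← Finset.sum_mul, ← Nat.cast_sum, Nat.sum_range_choose]
      push_cast
      ring

/-- The function `χ(x) ψ(y)`, as a continuous linear function of `ψ`. -/
def tensor (χ : 𝓢(ℝ, ℂ)) : 𝓢(ℝ, ℂ) →L[ℂ] 𝓢(ℝ × ℝ, ℂ) :=
  SchwartzMap.mkCLM (fun ψ p => χ p.1 * ψ p.2)
    (fun f g x => by rw [add_apply, mul_add])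
    (fun a f x => by simp only [smul_apply, smul_eq_mul, RingHom.id_apply]; ring)
    (fun f => ((χ.smooth ⊤).comp contDiff_fst).mul ((f.smooth ⊤).comp contDiff_snd))
    (fun m => ⟨Finset.Iic m, 2 ^ (m.2 + 2 * m.1)
      * (Finset.Iic m).sup (fun m => SchwartzMap.seminorm ℂ m.1 m.2) χ,
      mul_nonneg (by positivity) (apply_nonneg _ _), fun f x =>
        norm_pow_mul_iteratedFDeriv_tensor_le χ f m.1 m.2 x⟩)

theorem slice_tensor (χ ψ : 𝓢(ℝ, ℂ)) (x : ℝ) : slice x (tensor χ ψ) = χ x • ψ := by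
  ext y; rfl

theorem lineDerivOp_left_tensor (χ ψ : 𝓢(ℝ, ℂ)) :
    ∂_{((1 : ℝ), (0 : ℝ))} (tensor χ ψ) = tensor (SchwartzMap.derivCLM ℂ ℂ χ) ψ := by
  ext p
  exact (hasDerivAt_slice_left (tensor χ ψ) p.1 p.2).unique ((χ.hasDerivAt p.1).mul_const (ψ p.2))

theorem lineDerivOp_right_tensor (χ ψ : 𝓢(ℝ, ℂ)) :
    ∂_{((0 : ℝ), (1 : ℝ))} (tensor χ ψ) = tensor χ (SchwartzMap.derivCLM ℂ ℂ ψ) := by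
  ext p
  exact (hasDerivAt_slice_right (tensor χ ψ) p.1 p.2).unique ((ψ.hasDerivAt p.2).const_mul (χ p.1))

theorem tsupport_tensor_subset (χ ψ : 𝓢(ℝ, ℂ)) :
    tsupport (tensor χ ψ) ⊆ tsupport χ ×ˢ tsupport ψ := by
  refine closure_minimal (fun p hp => ?_) ((isClosed_tsupport _).prod (isClosed_tsupport _))
  have hp' : χ p.1 * ψ p.2 ≠ 0 := hp
  exact ⟨subset_tsupport _ (left_ne_zero_of_mul hp'), subset_tsupport _ (right_ne_zero_of_mul hp')⟩

theorem hasCompactSupport_tensor {χ ψ : 𝓢(ℝ, ℂ)} (hχ : HasCompactSupport χ)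
    (hψ : HasCompactSupport ψ) : HasCompactSupport (tensor χ ψ) :=
  (IsCompact.prod hχ hψ).of_isClosed_subset (isClosed_tsupport _) (tsupport_tensor_subset χ ψ)

theorem derivCLM_compSubConstCLM (t : ℝ) (χ : 𝓢(ℝ, ℂ)) :
    SchwartzMap.derivCLM ℂ ℂ (SchwartzMap.compSubConstCLM ℂ t χ) =
      SchwartzMap.compSubConstCLM ℂ t (SchwartzMap.derivCLM ℂ ℂ χ) := by
  ext x
  exact (χ.hasDerivAt (x - t)).comp_sub_const x t |>.deriv

theorem exists_seminorm_translate_le (k n : ℕ) (χ : 𝓢(ℝ, ℂ)) :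
    ∃ C : ℝ, ∀ t : ℝ, 0 ≤ t →
      SchwartzMap.seminorm ℂ k n (SchwartzMap.compSubConstCLM ℂ t χ) ≤ C * (1 + t) ^ k := by
  induction n generalizing χ with
  | zero =>
    set C := 2 ^ k * (Finset.Iic (k, 0)).sup (fun m => SchwartzMap.seminorm ℂ m.1 m.2) χ
    have hC : 0 ≤ C := mul_nonneg (by positivity) (apply_nonneg _ _)
    refine ⟨C, fun t ht => seminorm_zero_le (by positivity) fun x => ?_⟩
    have h1 := SchwartzMap.one_add_le_sup_seminorm_apply (𝕜 := ℂ) (m := (k, 0)) le_rfl le_rfl χ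
      (x - t)
    rw [norm_iteratedFDeriv_zero, Real.norm_eq_abs] at h1
    rw [SchwartzMap.compSubConstCLM_apply]
    have h2 : |x| ≤ (1 + |x - t|) * (1 + t) := by
      have : |x| ≤ |x - t| + t := by
        calc |x| = |(x - t) + t| := by ring_nf
          _ ≤ |x - t| + |t| := abs_add_le _ _
          _ = _ := by rw [abs_of_nonneg ht]
      nlinarith [abs_nonneg (x - t)]
    calc |x| ^ k * ‖χ (x - t)‖ ≤ ((1 + |x - t|) * (1 + t)) ^ k * ‖χ (x - t)‖ := by gcongr
      _ = ((1 + |x - t|) ^ k * ‖χ (x - t)‖) * (1 + t) ^ k := by rw [mul_pow]; ring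
      _ ≤ C * (1 + t) ^ k := by gcongr
  | succ n ih =>
    obtain ⟨C, hC⟩ := ih (SchwartzMap.derivCLM ℂ ℂ χ)
    refine ⟨C, fun t ht => ?_⟩
    rw [seminorm_succ, derivCLM_compSubConstCLM]
    exact hC t ht

/-- A tempered distribution on the plane, tested against translates in the first variable, grows
at most polynomially. -/
theorem exists_norm_apply_tensor_translate_le (V : 𝓢(ℝ × ℝ, ℂ) →L[ℂ] ℂ) (χ : 𝓢(ℝ, ℂ)) :
    ∃ (N : ℕ) (q : Seminorm ℂ 𝓢(ℝ, ℂ)), Continuous q ∧ ∀ t : ℝ, 0 ≤ t → ∀ ψ,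
      ‖V (tensor (SchwartzMap.compSubConstCLM ℂ t χ) ψ)‖ ≤ (1 + t) ^ N * q ψ := by
  have hV : Continuous ((normSeminorm ℂ ℂ).comp V.toLinearMap) := by
    change Continuous fun φ => ‖V φ‖
    fun_prop
  obtain ⟨S, C, hC, hb⟩ := exists_seminorm_le_sum hV
  choose D hD using fun m : ℕ × ℕ => exists_seminorm_translate_le m.1 m.2 χ
  have hsup : ∀ (m : ℕ × ℕ) (f : 𝓢(ℝ, ℂ)),
      (Finset.Iic m).sup (fun m => SchwartzMap.seminorm ℂ m.1 m.2) f ≤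
        ∑ i ∈ Finset.Iic m, SchwartzMap.seminorm ℂ i.1 i.2 f := fun m f => by
    refine (Seminorm.finset_sup_le_sum _ _ f).trans (le_of_eq ?_)
    simp
  set N := S.sup Prod.fst
  have hχ : ∀ m ∈ S, ∀ t : ℝ, 0 ≤ t → (Finset.Iic m).sup (fun m => SchwartzMap.seminorm ℂ m.1 m.2)
      (SchwartzMap.compSubConstCLM ℂ t χ) ≤ (1 + t) ^ N * ∑ i ∈ Finset.Iic m, |D i| := by
    intro m hm t ht
    refine (hsup m _).trans ?_
    rw [Finset.mul_sum]
    gcongr with i hi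
    have h1 : i.1 ≤ N := (Finset.mem_Iic.1 hi).1.trans (Finset.le_sup (f := Prod.fst) hm)
    calc _ ≤ D i * (1 + t) ^ i.1 := hD i t ht
      _ ≤ |D i| * (1 + t) ^ N := by
        gcongr
        · exact le_abs_self _
        · linarith
      _ = _ := mul_comm _ _
  have hq : ∀ m : ℕ × ℕ, ∃ q : Seminorm ℂ 𝓢(ℝ, ℂ), Continuous q ∧
      ∀ ψ, q ψ = (2 ^ (m.2 + 2 * m.1) * ∑ i ∈ Finset.Iic m, |D i|)
        * ∑ i ∈ Finset.Iic m, SchwartzMap.seminorm ℂ i.1 i.2 ψ := fun m =>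
    exists_seminorm_of_sum (E := 𝓢(ℝ, ℂ)) (Finset.Iic m) (C := 2 ^ (m.2 + 2 * m.1) * ∑ i ∈ Finset.Iic m, |D i|)
      (mul_nonneg (by positivity) (Finset.sum_nonneg fun _ _ => abs_nonneg _)) (fun i => SchwartzMap.seminorm ℂ i.1 i.2)
      fun i => continuous_seminorm i.1 i.2
  choose q hqc hq using hq
  obtain ⟨Q, hQc, hQ⟩ := exists_seminorm_of_sum S hC q hqc
  refine ⟨N, Q, hQc, fun t ht ψ => (hb _).trans ?_⟩
  rw [hQ, mul_left_comm, Finset.mul_sum ( a := (1 + t) ^ N)]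
  gcongr with m hm
  refine SchwartzMap.seminorm_le_bound ℂ _ _ _ ?_ fun p =>
    (norm_pow_mul_iteratedFDeriv_tensor_le _ ψ m.1 m.2 p).trans ?_
  · exact mul_nonneg (by positivity) (apply_nonneg _ _)
  · rw [hq]
    calc _ ≤ 2 ^ (m.2 + 2 * m.1) * ((1 + t) ^ N * ∑ i ∈ Finset.Iic m, |D i|)
          * ∑ i ∈ Finset.Iic m, SchwartzMap.seminorm ℂ i.1 i.2 ψ := by
          have h3 : 0 ≤ ∑ i ∈ Finset.Iic m, |D i| := Finset.sum_nonneg fun _ _ => abs_nonneg _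
          gcongr
          · exact hχ m hm t ht
          · exact hsup m ψ
      _ = _ := by ring

/-! ### The symbols -/

/-- The radicand `1 - 2 ε k_y η / k_x² + 2 i ν ε k_y² / k_x²`. -/
def radicand (ε ν kx ky η : ℝ) : ℂ :=
  1 - 2 * (ε * ky * η / kx ^ 2) + 2 * Complex.I * ν * (ε * ky ^ 2 / kx ^ 2)

/-- The other root `R₊(iη)` of the characteristic polynomial. -/
def Rplus (ε ν kx ky η : ℝ) : ℂ :=
  Complex.I * (kx * η / ky) - Complex.I * (kx / (ε * ky ^ 2)) * (1 + rootS ε ν kx ky η)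

/-- The polynomial in the Fourier variable that multiplies `∂_x`. -/
def symB (ε kx ky η : ℝ) : ℂ := Complex.I * kx - Complex.I * ε * kx * ky * η

/-- The zeroth order term of the equation in the Fourier variable. -/
def symC (ε ν kx ky η : ℝ) : ℂ := -(ky * η) - ε * kx ^ 2 * η ^ 2 / 2 + Complex.I * ν

section Symbols

variable {ε ν kx ky : ℝ}

theorem rootS_sq (η : ℝ) : rootS ε ν kx ky η ^ 2 = radicand ε ν kx ky η := by
  have := Complex.cpow_nat_inv_pow (radicand ε ν kx ky η) (n := 2) two_ne_zero
  exact_mod_cast this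

theorem radicand_im (η : ℝ) : (radicand ε ν kx ky η).im = 2 * ν * (ε * ky ^ 2 / kx ^ 2) := by
  have : radicand ε ν kx ky η = ((1 - 2 * (ε * ky * η / kx ^ 2) : ℝ) : ℂ)
      + ((2 * ν * (ε * ky ^ 2 / kx ^ 2) : ℝ) : ℂ) * Complex.I := by
    simp only [radicand]; push_cast; ring
  rw [this]
  simp [-Complex.ofReal_mul, -Complex.ofReal_div, -Complex.ofReal_sub]

theorem radicand_im_pos (hε : 0 < ε) (hν : 0 < ν) (hkx : 0 < kx) (hky : ky ≠ 0) (η : ℝ) :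
    0 < (radicand ε ν kx ky η).im := by
  rw [radicand_im]
  positivity

theorem rootS_re_nonneg (η : ℝ) : 0 ≤ (rootS ε ν kx ky η).re := by
  change 0 ≤ (radicand ε ν kx ky η ^ (2⁻¹ : ℂ)).re
  rw [Complex.cpow_inv_two_re]
  exact Real.sqrt_nonneg _

theorem rootS_re_mul_im (η : ℝ) :
    2 * ((rootS ε ν kx ky η).re * (rootS ε ν kx ky η).im) = (radicand ε ν kx ky η).im := by
  rw [← rootS_sq, sq, Complex.mul_im]
  ring

theorem rootS_re_pos (hε : 0 < ε) (hν : 0 < ν) (hkx : 0 < kx) (hky : ky ≠ 0) (η : ℝ) :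
    0 < (rootS ε ν kx ky η).re := by
  refine (rootS_re_nonneg η).lt_of_ne fun h => ?_
  have h1 := rootS_re_mul_im (ε := ε) (ν := ν) (kx := kx) (ky := ky) η
  have h2 := radicand_im_pos hε hν hkx hky η
  rw [← h] at h1
  linarith

theorem rootS_im_pos (hε : 0 < ε) (hν : 0 < ν) (hkx : 0 < kx) (hky : ky ≠ 0) (η : ℝ) :
    0 < (rootS ε ν kx ky η).im := by
  have h1 := rootS_re_mul_im (ε := ε) (ν := ν) (kx := kx) (ky := ky) η
  have h2 := radicand_im_pos hε hν hkx hky η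
  have h3 := rootS_re_pos hε hν hkx hky η
  by_contra hcon
  nlinarith

theorem radicand_ne_zero (hε : 0 < ε) (hν : 0 < ν) (hkx : 0 < kx) (hky : ky ≠ 0) (η : ℝ) :
    radicand ε ν kx ky η ≠ 0 := fun h => by
  have := radicand_im_pos hε hν hkx hky η
  rw [h] at this
  simp at this

theorem hasTemperateGrowth_radicand : (radicand ε ν kx ky).HasTemperateGrowth := by
  have e : radicand ε ν kx ky = fun η : ℝ => (1 + 2 * Complex.I * ν * (ε * ky ^ 2 / kx ^ 2))
      - (2 * (ε * ky / kx ^ 2) : ℂ) * (η : ℂ) := by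
    funext η; simp only [radicand]; ring
  rw [e]
  exact (Function.HasTemperateGrowth.const _).sub
    ((Function.HasTemperateGrowth.const _).mul Function.Complex.hasTemperateGrowth_ofReal)

theorem hasDerivAt_rootS (hε : 0 < ε) (hν : 0 < ν) (hkx : 0 < kx) (hky : ky ≠ 0) (η : ℝ) :
    HasDerivAt (rootS ε ν kx ky)
      (deriv (radicand ε ν kx ky) η / 2 * (radicand ε ν kx ky η)⁻¹ * rootS ε ν kx ky η) η := by
  have h1 : HasDerivAt (radicand ε ν kx ky) (deriv (radicand ε ν kx ky) η) η :=
    (hasTemperateGrowth_radicand.differentiable η).hasDerivAt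
  have h2 : DifferentiableAt ℝ (rootS ε ν kx ky) η :=
    ((Complex.hasDerivAt_sqrt (.inr (radicand_im_pos hε hν hkx hky η).ne')).comp η h1).differentiableAt
  have h3 := (h2.hasDerivAt.pow 2).unique (h1.congr_of_eventuallyEq
    (Eventually.of_forall fun x => rootS_sq x))
  have h0 := radicand_ne_zero hε hν hkx hky η
  refine h2.hasDerivAt.congr_deriv ?_
  rw [← h3, ← rootS_sq]
  rw [← rootS_sq] at h0
  have h4 : rootS ε ν kx ky η ≠ 0 := fun h => h0 (by simp [h])
  field_simp
  simp

theorem norm_rootS_le (η : ℝ) : ‖rootS ε ν kx ky η‖ ≤ 1 + ‖radicand ε ν kx ky η‖ := by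
  rw [← rootS_sq, norm_pow]
  nlinarith [sq_nonneg (‖rootS ε ν kx ky η‖ - 1), norm_nonneg (rootS ε ν kx ky η)]

theorem exists_norm_rootS_le : ∃ (K : ℕ) (D : ℝ), 0 ≤ D ∧
    ∀ η, ‖rootS ε ν kx ky η‖ ≤ D * (1 + ‖η‖) ^ K := by
  obtain ⟨K, D, hD, h⟩ := (hasTemperateGrowth_radicand (ε := ε) (ν := ν) (kx := kx) (ky := ky)).norm_le
  refine ⟨K, 1 + D, by positivity, fun η => (norm_rootS_le η).trans ?_⟩
  have : 1 ≤ (1 + ‖η‖) ^ K := one_le_pow₀ (by linarith [norm_nonneg η])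
  linarith [h η]

theorem hasTemperateGrowth_rootS (hε : 0 < ε) (hν : 0 < ν) (hkx : 0 < kx) (hky : ky ≠ 0) :
    (rootS ε ν kx ky).HasTemperateGrowth := by
  obtain ⟨K, D, -, h⟩ := exists_norm_rootS_le (ε := ε) (ν := ν) (kx := kx) (ky := ky)
  have hc : 0 < 2 * ν * (ε * ky ^ 2 / kx ^ 2) := by positivity
  have hi := hasTemperateGrowth_inv (hasTemperateGrowth_radicand (ε := ε) (ν := ν) (kx := kx)
    (ky := ky)) hc fun η => by
      rw [← radicand_im (ε := ε) (ν := ν) (kx := kx) (ky := ky) η]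
      exact (le_abs_self _).trans (Complex.abs_im_le_norm _)
  have hd : (fun η => deriv (radicand ε ν kx ky) η / 2 * (radicand ε ν kx ky η)⁻¹).HasTemperateGrowth := by
    simp only [div_eq_mul_inv]
    exact ((hasTemperateGrowth_radicand.deriv).mul (.const _)).mul hi
  exact hasTemperateGrowth_of_hasDerivAt_mul hd (hasDerivAt_rootS hε hν hkx hky) h

theorem hasTemperateGrowth_Rminus (hε : 0 < ε) (hν : 0 < ν) (hkx : 0 < kx) (hky : ky ≠ 0) :
    (Rminus ε ν kx ky).HasTemperateGrowth := by
  have e : Rminus ε ν kx ky = fun η : ℝ => (Complex.I * kx / ky) * (η : ℂ)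
      - Complex.I * (kx / (ε * ky ^ 2)) * (1 - rootS ε ν kx ky η) := by
    funext η; simp only [Rminus]; ring
  rw [e]
  exact ((Function.HasTemperateGrowth.const _).mul Function.Complex.hasTemperateGrowth_ofReal).sub
    ((Function.HasTemperateGrowth.const _).mul
      ((Function.HasTemperateGrowth.const _).sub (hasTemperateGrowth_rootS hε hν hkx hky)))

theorem hasTemperateGrowth_Rplus (hε : 0 < ε) (hν : 0 < ν) (hkx : 0 < kx) (hky : ky ≠ 0) :
    (Rplus ε ν kx ky).HasTemperateGrowth := by
  have e : Rplus ε ν kx ky = fun η : ℝ => (Complex.I * kx / ky) * (η : ℂ)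
      - Complex.I * (kx / (ε * ky ^ 2)) * (1 + rootS ε ν kx ky η) := by
    funext η; simp only [Rplus]; ring
  rw [e]
  exact ((Function.HasTemperateGrowth.const _).mul Function.Complex.hasTemperateGrowth_ofReal).sub
    ((Function.HasTemperateGrowth.const _).mul
      ((Function.HasTemperateGrowth.const _).add (hasTemperateGrowth_rootS hε hν hkx hky)))

theorem Rminus_re (η : ℝ) :
    (Rminus ε ν kx ky η).re = -(kx / (ε * ky ^ 2) * (rootS ε ν kx ky η).im) := by
  have e : Rminus ε ν kx ky η = Complex.I * ((kx * η / ky : ℝ) : ℂ)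
      - Complex.I * ((kx / (ε * ky ^ 2) : ℝ) : ℂ) * (1 - rootS ε ν kx ky η) := by
    simp only [Rminus]; push_cast; ring
  rw [e]
  simp [-Complex.ofReal_mul, -Complex.ofReal_div]

theorem Rplus_re (η : ℝ) :
    (Rplus ε ν kx ky η).re = kx / (ε * ky ^ 2) * (rootS ε ν kx ky η).im := by
  have e : Rplus ε ν kx ky η = Complex.I * ((kx * η / ky : ℝ) : ℂ)
      - Complex.I * ((kx / (ε * ky ^ 2) : ℝ) : ℂ) * (1 + rootS ε ν kx ky η) := by
    simp only [Rplus]; push_cast; ring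
  rw [e]
  simp [-Complex.ofReal_mul, -Complex.ofReal_div]

theorem Rminus_re_neg (hε : 0 < ε) (hν : 0 < ν) (hkx : 0 < kx) (hky : ky ≠ 0) (η : ℝ) :
    (Rminus ε ν kx ky η).re < 0 := by
  rw [Rminus_re, neg_lt_zero]
  exact mul_pos (by positivity) (rootS_im_pos hε hν hkx hky η)

theorem Rplus_re_pos (hε : 0 < ε) (hν : 0 < ν) (hkx : 0 < kx) (hky : ky ≠ 0) (η : ℝ) :
    0 < (Rplus ε ν kx ky η).re := by
  rw [Rplus_re]
  exact mul_pos (by positivity) (rootS_im_pos hε hν hkx hky η)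

/-- `Re R₊` is bounded below by a negative power of `1 + |η|`. -/
theorem exists_one_le_mul_Rplus_re (hε : 0 < ε) (hν : 0 < ν) (hkx : 0 < kx) (hky : ky ≠ 0) :
    ∃ (K : ℕ) (D : ℝ), ∀ η, 1 ≤ D * (1 + |η|) ^ K * (Rplus ε ν kx ky η).re := by
  obtain ⟨K, D, -, h⟩ := exists_norm_rootS_le (ε := ε) (ν := ν) (kx := kx) (ky := ky)
  have hc : 0 < 2 * ν * (ε * ky ^ 2 / kx ^ 2) := by positivity
  set c := 2 * ν * (ε * ky ^ 2 / kx ^ 2) with hcdef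
  set a := kx / (ε * ky ^ 2) with ha
  have ha0 : 0 < a := by positivity
  refine ⟨K, 2 * D / (c * a), fun η => ?_⟩
  have h1 := rootS_re_mul_im (ε := ε) (ν := ν) (kx := kx) (ky := ky) η
  rw [radicand_im, ← hcdef] at h1
  have h2 := rootS_im_pos hε hν hkx hky η
  have h3 := (Complex.re_le_norm (rootS ε ν kx ky η)).trans (h η)
  rw [Real.norm_eq_abs] at h3
  rw [Rplus_re, ← ha]
  have h4 : 2 * D / (c * a) * (1 + |η|) ^ K * (a * (rootS ε ν kx ky η).im)
      = 2 * (D * (1 + |η|) ^ K * (rootS ε ν kx ky η).im) / c := by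
    field_simp
  rw [h4, le_div_iff₀ hc, one_mul, ← h1]
  gcongr

theorem one_le_norm_one_add_rootS (η : ℝ) : 1 ≤ ‖1 + rootS ε ν kx ky η‖ := by
  refine le_trans ?_ (Complex.re_le_norm _)
  rw [Complex.add_re, Complex.one_re]
  linarith [rootS_re_nonneg (ε := ε) (ν := ν) (kx := kx) (ky := ky) η]

theorem one_add_rootS_ne_zero (η : ℝ) : 1 + rootS ε ν kx ky η ≠ 0 :=
  norm_pos_iff.1 (one_pos.trans_le (one_le_norm_one_add_rootS η))

/-- The factor `2 / (1 + √(…))`. -/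
def transmission (ε ν kx ky η : ℝ) : ℂ := 2 / (1 + rootS ε ν kx ky η)

theorem hasTemperateGrowth_transmission (hε : 0 < ε) (hν : 0 < ν) (hkx : 0 < kx) (hky : ky ≠ 0) :
    (transmission ε ν kx ky).HasTemperateGrowth :=
  (Function.HasTemperateGrowth.const (2 : ℂ)).mul (hasTemperateGrowth_inv
    ((Function.HasTemperateGrowth.const 1).add (hasTemperateGrowth_rootS hε hν hkx hky)) one_pos
    one_le_norm_one_add_rootS)

theorem hasTemperateGrowth_propagator (hε : 0 < ε) (hν : 0 < ν) (hkx : 0 < kx) (hky : ky ≠ 0)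
    {x : ℝ} (hx : 0 ≤ x) : (propagator ε ν kx ky x).HasTemperateGrowth :=
  (hasTemperateGrowth_transmission hε hν hkx hky).mul
    (hasTemperateGrowth_cexp (hasTemperateGrowth_Rminus hε hν hkx hky)
      (fun η => (Rminus_re_neg hε hν hkx hky η).le) hx)

theorem hasTemperateGrowth_symB : (symB ε kx ky).HasTemperateGrowth :=
  (Function.HasTemperateGrowth.const _).sub
    ((Function.HasTemperateGrowth.const _).mul Function.Complex.hasTemperateGrowth_ofReal)

theorem hasTemperateGrowth_symC : (symC ε ν kx ky).HasTemperateGrowth := by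
  have e : symC ε ν kx ky = fun η : ℝ => -((ky : ℂ) * (η : ℂ)) - (ε * kx ^ 2 / 2 : ℂ) * (η : ℂ) ^ 2
      + Complex.I * ν := by
    funext η; simp only [symC]; ring
  rw [e]
  exact ((((Function.HasTemperateGrowth.const _).mul Function.Complex.hasTemperateGrowth_ofReal).neg).sub
    ((Function.HasTemperateGrowth.const _).mul (Function.Complex.hasTemperateGrowth_ofReal.pow 2))).add
    (.const _)

theorem Rminus_add_Rplus (hε : 0 < ε) (hky : ky ≠ 0) (η : ℝ) :
    (ε * ky ^ 2 / 2 : ℂ) * (Rminus ε ν kx ky η + Rplus ε ν kx ky η) = -symB ε kx ky η := by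
  have h1 : (ε : ℂ) ≠ 0 := by exact_mod_cast hε.ne'
  have h2 : (ky : ℂ) ≠ 0 := by exact_mod_cast hky
  simp only [Rminus, Rplus, symB]
  field_simp
  ring

theorem Rminus_mul_Rplus (hε : 0 < ε) (hkx : 0 < kx) (hky : ky ≠ 0)
    (hk : kx ^ 2 + ky ^ 2 = 1) (η : ℝ) :
    (ε * ky ^ 2 / 2 : ℂ) * (Rminus ε ν kx ky η * Rplus ε ν kx ky η) = symC ε ν kx ky η := by
  have h1 : (ε : ℂ) ≠ 0 := by exact_mod_cast hε.ne'
  have h2 : (ky : ℂ) ≠ 0 := by exact_mod_cast hky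
  have h3 : (kx : ℂ) ≠ 0 := by exact_mod_cast hkx.ne'
  have hk' : (kx : ℂ) ^ 2 + (ky : ℂ) ^ 2 = 1 := by exact_mod_cast hk
  have hS := rootS_sq (ε := ε) (ν := ν) (kx := kx) (ky := ky) η
  have e : Rminus ε ν kx ky η * Rplus ε ν kx ky η =
      -(kx * η / ky - kx / (ε * ky ^ 2)) ^ 2 + (kx / (ε * ky ^ 2)) ^ 2 * rootS ε ν kx ky η ^ 2 := by
    simp only [Rminus, Rplus]
    ring_nf
    simp only [Complex.I_sq]
    ring
  rw [e, hS]
  simp only [radicand, symC]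
  field_simp
  linear_combination (2 * ε * ky * η : ℂ) * hk'

theorem boundary_symbol (hε : 0 < ε) (hky : ky ≠ 0) (η : ℝ) :
    Complex.I * ε * ky * (kx * (Complex.I * η) - ky * Rminus ε ν kx ky η) + 2 * kx =
      kx * (1 + rootS ε ν kx ky η) := by
  have h1 : (ε : ℂ) ≠ 0 := by exact_mod_cast hε.ne'
  have h2 : (ky : ℂ) ≠ 0 := by exact_mod_cast hky
  simp only [Rminus]
  field_simp
  ring_nf
  simp only [Complex.I_sq]
  ring

end Symbols

/-! ### The Fourier transform on Schwartz functions of one variable -/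

/-- The inverse of `schwartzFourier`. -/
def schwartzFourierInv : 𝓢(ℝ, ℂ) →L[ℂ] 𝓢(ℝ, ℂ) :=
  (FourierTransform.fourierInvCLM ℂ 𝓢(ℝ, ℂ)).comp
    (SchwartzMap.compCLMOfContinuousLinearEquiv ℂ
      (ContinuousLinearEquiv.unitsEquivAut ℝ
        (Units.mk0 (2 * Real.pi)⁻¹ (inv_ne_zero Real.two_pi_pos.ne'))).symm)

@[simp]
theorem schwartzFourier_fourierInv (φ : 𝓢(ℝ, ℂ)) : schwartzFourier (schwartzFourierInv φ) = φ := by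
  ext x
  simp only [schwartzFourier, schwartzFourierInv, ContinuousLinearMap.comp_apply,
    FourierTransform.fourierCLM_apply, FourierTransform.fourierInvCLM_apply,
    FourierTransform.fourier_fourierInv_eq, SchwartzMap.compCLMOfContinuousLinearEquiv_apply,
    Function.comp_apply, ContinuousLinearEquiv.symm_apply_apply]

@[simp]
theorem schwartzFourierInv_fourier (φ : 𝓢(ℝ, ℂ)) : schwartzFourierInv (schwartzFourier φ) = φ := by
  have h : ∀ ψ : 𝓢(ℝ, ℂ), SchwartzMap.compCLMOfContinuousLinearEquiv ℂ
      (ContinuousLinearEquiv.unitsEquivAut ℝ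
        (Units.mk0 (2 * Real.pi)⁻¹ (inv_ne_zero Real.two_pi_pos.ne'))).symm
      (SchwartzMap.compCLMOfContinuousLinearEquiv ℂ
      (ContinuousLinearEquiv.unitsEquivAut ℝ
        (Units.mk0 (2 * Real.pi)⁻¹ (inv_ne_zero Real.two_pi_pos.ne'))) ψ) = ψ := fun ψ => by
    ext x
    simp only [SchwartzMap.compCLMOfContinuousLinearEquiv_apply,
      Function.comp_apply, ContinuousLinearEquiv.apply_symm_apply]
  simp only [schwartzFourier, schwartzFourierInv, ContinuousLinearMap.comp_apply, h,
    FourierTransform.fourierCLM_apply, FourierTransform.fourierInvCLM_apply,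
    FourierTransform.fourierInv_fourier_eq]

/-- The function `η ↦ iη`. -/
def iEta (η : ℝ) : ℂ := Complex.I * η

theorem hasTemperateGrowth_iEta : iEta.HasTemperateGrowth :=
  (Function.HasTemperateGrowth.const _).mul Function.Complex.hasTemperateGrowth_ofReal

theorem derivCLM_schwartzFourier (φ : 𝓢(ℝ, ℂ)) :
    SchwartzMap.derivCLM ℂ ℂ (schwartzFourier φ) =
      -schwartzFourier (SchwartzMap.smulLeftCLM ℂ iEta φ) := by
  ext η
  set m := SchwartzMap.smulLeftCLM ℂ iEta φ with hm
  have hmx : ∀ x, m x = Complex.I * x * φ x := fun x => smulLeft_apply hasTemperateGrowth_iEta φ x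
  have h1 : ∀ (ψ : 𝓢(ℝ, ℂ)) (η : ℝ), schwartzFourier ψ η = 𝓕 (ψ : ℝ → ℂ) (η * (2 * Real.pi)⁻¹) :=
    fun _ _ => rfl
  have hint : Integrable fun x : ℝ => x • φ x := by
    have := (m.integrable (μ := volume)).const_mul (-Complex.I)
    refine this.congr (Eventually.of_forall fun x => ?_)
    simp only [hmx, Complex.real_smul]
    linear_combination (-(x : ℂ) * φ x) * Complex.I_sq
  have h2 := Real.hasDerivAt_fourier (φ.integrable (μ := volume)) hint (η * (2 * Real.pi)⁻¹)
  have h3 := h2.scomp η ((hasDerivAt_id η).mul_const (2 * Real.pi)⁻¹)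
  have e : ⇑(schwartzFourier φ) = 𝓕 (φ : ℝ → ℂ) ∘ fun η => id η * (2 * Real.pi)⁻¹ := rfl
  rw [SchwartzMap.derivCLM_apply, neg_apply, h1, e, h3.deriv, one_mul, Real.fourier_eq',
    Real.fourier_eq', ← integral_smul, ← integral_neg]
  refine integral_congr_ae (Eventually.of_forall fun x => ?_)
  have hp : (Real.pi : ℂ) ≠ 0 := by exact_mod_cast Real.pi_ne_zero
  simp only [hmx, smul_eq_mul, Complex.real_smul]
  push_cast
  field_simp

theorem schwartzFourierInv_derivCLM (ψ : 𝓢(ℝ, ℂ)) :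
    schwartzFourierInv (SchwartzMap.derivCLM ℂ ℂ ψ) =
      -SchwartzMap.smulLeftCLM ℂ iEta (schwartzFourierInv ψ) := by
  have h := derivCLM_schwartzFourier (schwartzFourierInv ψ)
  rw [schwartzFourier_fourierInv] at h
  rw [h, map_neg, schwartzFourierInv_fourier]

theorem fourierY_derivCLM (T : 𝓢'(ℝ, ℂ)) (φ : 𝓢(ℝ, ℂ)) :
    fourierY (TemperedDistribution.derivCLM ℂ T) φ =
      fourierY T (SchwartzMap.smulLeftCLM ℂ iEta φ) := by
  rw [fourierY_apply, fourierY_apply, TemperedDistribution.derivCLM_apply_apply,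
    derivCLM_schwartzFourier, neg_neg]

/-- The inverse of `fourierY`. -/
def fourierYInv : 𝓢'(ℝ, ℂ) →L[ℂ] 𝓢'(ℝ, ℂ) :=
  PointwiseConvergenceCLM.precomp ℂ schwartzFourierInv

theorem fourierYInv_apply (T : 𝓢'(ℝ, ℂ)) (ψ : 𝓢(ℝ, ℂ)) :
    fourierYInv T ψ = T (schwartzFourierInv ψ) := rfl

theorem fourierY_fourierYInv (T : 𝓢'(ℝ, ℂ)) : fourierY (fourierYInv T) = T := by
  ext φ
  rw [fourierY_apply, fourierYInv_apply, schwartzFourierInv_fourier]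

theorem fourierY_injective : Function.Injective fourierY := by
  intro S T h
  ext ψ
  have := congrArg (fun U : 𝓢'(ℝ, ℂ) => U (schwartzFourierInv ψ)) h
  simpa using this

/-! ### Existence -/

/-- The functional `ψ ↦ ⟨e^{r x} G, F⁻¹ ψ⟩`. -/
def evolve (r : ℝ → ℂ) (G : 𝓢(ℝ, ℂ) →L[ℂ] ℂ) (x : ℝ) : 𝓢(ℝ, ℂ) →L[ℂ] ℂ :=
  G.comp ((mulExp r x).comp schwartzFourierInv)

section Evolve

variable {r : ℝ → ℂ}

theorem evolve_apply (r : ℝ → ℂ) (G : 𝓢(ℝ, ℂ) →L[ℂ] ℂ) (x : ℝ) (ψ : 𝓢(ℝ, ℂ)) :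
    evolve r G x ψ = G (mulExp r x (schwartzFourierInv ψ)) := rfl

theorem hasDerivWithinAt_clm_curve (G : 𝓢(ℝ, ℂ) →L[ℂ] ℂ) {c : ℝ → 𝓢(ℝ, ℂ)} {c' : 𝓢(ℝ, ℂ)}
    {S : Set ℝ} {t : ℝ} (hc : Tendsto (slope c t) (𝓝[S \ {t}] t) (𝓝 c')) :
    HasDerivWithinAt (fun s => G (c s)) (G c') S t := by
  obtain ⟨q, hq, hb⟩ := exists_seminorm_bound G
  have := hasDerivWithinAt_apply_curve (T := fun _ => G.toLinearMap) hq
    (Eventually.of_forall fun _ => hb) tendsto_const_nhds (hasDerivWithinAt_const ..) hc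
  simpa using this

theorem hasDerivWithinAt_evolve (hr : r.HasTemperateGrowth) (hre : ∀ η, (r η).re ≤ 0)
    (G : 𝓢(ℝ, ℂ) →L[ℂ] ℂ) {x : ℝ} (hx : 0 ≤ x) (ψ : 𝓢(ℝ, ℂ)) :
    HasDerivWithinAt (fun t => evolve r G t ψ)
      (evolve r (G.comp (SchwartzMap.smulLeftCLM ℂ r)) x ψ) (Set.Ici 0) x := by
  have h := hasDerivWithinAt_clm_curve G (tendsto_slope_mulExp hr hre hx (schwartzFourierInv ψ))
  rw [mulExp_comm hr hre hx hr] at h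
  exact h

theorem exists_seminorm_evolve_le (hr : r.HasTemperateGrowth) (hre : ∀ η, (r η).re ≤ 0)
    (G : 𝓢(ℝ, ℂ) →L[ℂ] ℂ) :
    ∃ (N : ℕ) (q : Seminorm ℂ 𝓢(ℝ, ℂ)), Continuous q ∧ ∀ x : ℝ, 0 ≤ x → ∀ ψ,
      ‖evolve r G x ψ‖ ≤ (1 + x) ^ N * q ψ := by
  obtain ⟨p, hp, hb⟩ := exists_seminorm_bound G
  obtain ⟨N, q, hq, hb'⟩ := exists_seminorm_comp_mulExp_le hr hre hp
  exact ⟨N, q.comp schwartzFourierInv.toLinearMap, hq.comp schwartzFourierInv.continuous,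
    fun x hx ψ => (hb _).trans (hb' x hx _)⟩

theorem hasDerivWithinAt_evolve_slice (hr : r.HasTemperateGrowth) (hre : ∀ η, (r η).re ≤ 0)
    (G : 𝓢(ℝ, ℂ) →L[ℂ] ℂ) {x : ℝ} (hx : 0 ≤ x) (Φ : 𝓢(ℝ × ℝ, ℂ)) :
    HasDerivWithinAt (fun t => evolve r G t (slice t Φ))
      (evolve r (G.comp (SchwartzMap.smulLeftCLM ℂ r)) x (slice x Φ)
        + evolve r G x (slice x (∂_{((1 : ℝ), (0 : ℝ))} Φ))) (Set.Ici 0) x := by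
  obtain ⟨N, q, hq, hb⟩ := exists_seminorm_evolve_le hr hre G
  obtain ⟨Q, hQ, hQe⟩ : ∃ Q : Seminorm ℂ 𝓢(ℝ, ℂ), Continuous Q ∧ ∀ ψ, Q ψ = (2 + x) ^ N * q ψ :=
    exists_seminorm_eq_mul hq (by positivity)
  refine hasDerivWithinAt_apply_curve (T := fun t => (evolve r G t).toLinearMap) hQ ?_ ?_
    (hasDerivWithinAt_evolve hr hre G hx _) (tendsto_slope_slice x Φ _)
  · filter_upwards [self_mem_nhdsWithin,
      mem_nhdsWithin_of_mem_nhds (Iio_mem_nhds (lt_add_one x))] with t ht ht1 ψ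
    refine (hb t ht ψ).trans ?_
    rw [hQe]
    have h0 : (0 : ℝ) ≤ t := ht
    have h1 : t < x + 1 := ht1
    exact mul_le_mul_of_nonneg_right (pow_le_pow_left₀ (by linarith) (by linarith) N)
      (apply_nonneg q ψ)
  · exact (hasDerivWithinAt_evolve hr hre G hx _).continuousWithinAt

theorem exists_seminorm_evolve_slice_le (hr : r.HasTemperateGrowth) (hre : ∀ η, (r η).re ≤ 0)
    (G : 𝓢(ℝ, ℂ) →L[ℂ] ℂ) :
    ∃ q : Seminorm ℂ 𝓢(ℝ × ℝ, ℂ), Continuous q ∧ ∀ x : ℝ, 0 ≤ x → ∀ Φ,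
      ‖evolve r G x (slice x Φ)‖ ≤ q Φ * (1 + x ^ 2)⁻¹ := by
  obtain ⟨N, q, hq, hb⟩ := exists_seminorm_evolve_le hr hre G
  obtain ⟨p, hp, hb'⟩ := exists_seminorm_pow_mul_slice_le hq (N + 1)
  obtain ⟨Q, hQ, hQe⟩ : ∃ Q : Seminorm ℂ 𝓢(ℝ × ℝ, ℂ), Continuous Q ∧ ∀ ψ, Q ψ = 2 ^ N * p ψ :=
    exists_seminorm_eq_mul hp (by positivity)
  refine ⟨Q, hQ, fun x hx Φ => (hb x hx _).trans ?_⟩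
  have h1 : 0 < 1 + x ^ 2 := by positivity
  rw [hQe, ← div_eq_mul_inv, le_div_iff₀ h1]
  have h2 : 1 + x ≤ 2 * (1 + x ^ 2) := by nlinarith [sq_nonneg (x - 1)]
  calc (1 + x) ^ N * q (slice x Φ) * (1 + x ^ 2)
      ≤ (2 * (1 + x ^ 2)) ^ N * q (slice x Φ) * (1 + x ^ 2) := by gcongr
    _ = 2 ^ N * ((1 + x ^ 2) ^ (N + 1) * q (slice x Φ)) := by rw [mul_pow]; ring
    _ ≤ _ := by gcongr; exact hb' x Φ

theorem integrableOn_evolve_slice (hr : r.HasTemperateGrowth) (hre : ∀ η, (r η).re ≤ 0)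
    (G : 𝓢(ℝ, ℂ) →L[ℂ] ℂ) (Φ : 𝓢(ℝ × ℝ, ℂ)) :
    IntegrableOn (fun x => evolve r G x (slice x Φ)) (Set.Ioi 0) := by
  obtain ⟨q, -, hb⟩ := exists_seminorm_evolve_slice_le hr hre G
  refine Integrable.mono' (g := fun x => q Φ * (1 + x ^ 2)⁻¹)
    (integrable_inv_one_add_sq.const_mul _).integrableOn ?_ ?_
  · refine ContinuousOn.aestronglyMeasurable (fun x hx => ?_) measurableSet_Ioi
    exact (hasDerivWithinAt_evolve_slice hr hre G (le_of_lt hx) Φ).continuousWithinAt.mono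
      Set.Ioi_subset_Ici_self
  · exact (ae_restrict_iff' measurableSet_Ioi).2
      (Eventually.of_forall fun x hx => hb x (le_of_lt hx) Φ)

/-- The distribution `1_{x > 0} u(x, ·)` on the plane, for `u = F⁻¹ (e^{r x} G)`. -/
theorem exists_zeroExtension (hr : r.HasTemperateGrowth) (hre : ∀ η, (r η).re ≤ 0)
    (G : 𝓢(ℝ, ℂ) →L[ℂ] ℂ) :
    ∃ V : 𝓢(ℝ × ℝ, ℂ) →L[ℂ] ℂ, ∀ Φ, V Φ = ∫ x in Set.Ioi (0 : ℝ), evolve r G x (slice x Φ) := by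
  have hi := integrableOn_evolve_slice hr hre G
  obtain ⟨q, hq, hb⟩ := exists_seminorm_evolve_slice_le hr hre G
  obtain ⟨S, C, -, hC⟩ := Seminorm.bound_of_continuous (schwartz_withSeminorms ℂ (ℝ × ℝ) ℂ) q hq
  set I := ∫ x in Set.Ioi (0 : ℝ), (1 + x ^ 2)⁻¹
  have hI : 0 ≤ I := integral_nonneg fun x => by positivity
  refine ⟨SchwartzMap.mkCLMtoNormedSpace (σ := RingHom.id ℂ)
    (fun Φ => ∫ x in Set.Ioi (0 : ℝ), evolve r G x (slice x Φ)) (fun Φ Ψ => ?_) (fun a Φ => ?_)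
    ⟨S, C * I, mul_nonneg C.2 hI, fun Φ => ?_⟩, fun Φ => rfl⟩
  · rw [← integral_add (hi Φ) (hi Ψ)]
    simp only [map_add]
  · rw [← integral_smul]
    simp only [map_smul, RingHom.id_apply]
  · calc _ ≤ ∫ x in Set.Ioi (0 : ℝ), q Φ * (1 + x ^ 2)⁻¹ := by
          refine norm_integral_le_of_norm_le (integrable_inv_one_add_sq.const_mul _).integrableOn ?_
          exact (ae_restrict_iff' measurableSet_Ioi).2
            (Eventually.of_forall fun x hx => hb x (le_of_lt hx) Φ)
      _ = q Φ * I := integral_const_mul _ _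
      _ ≤ (C * S.sup (schwartzSeminormFamily ℂ (ℝ × ℝ) ℂ) Φ) * I := by
          gcongr
          exact hC Φ
      _ = _ := by ring

/-- The transpose of `paraxialOp`, on test functions. -/
def paraxialOpT (ε ν kx ky : ℝ) (Φ : 𝓢(ℝ × ℝ, ℂ)) : 𝓢(ℝ × ℝ, ℂ) :=
  -(Complex.I • ((kx : ℂ) • ∂_{((1 : ℝ), (0 : ℝ))} Φ + (ky : ℂ) • ∂_{((0 : ℝ), (1 : ℝ))} Φ))
    + ((ε : ℂ) / 2) • (((kx : ℂ) ^ 2) • ∂_{((0 : ℝ), (1 : ℝ))} (∂_{((0 : ℝ), (1 : ℝ))} Φ)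
        - (2 * (kx : ℂ) * ky) • ∂_{((0 : ℝ), (1 : ℝ))} (∂_{((1 : ℝ), (0 : ℝ))} Φ)
        + ((ky : ℂ) ^ 2) • ∂_{((1 : ℝ), (0 : ℝ))} (∂_{((1 : ℝ), (0 : ℝ))} Φ))
    + (Complex.I * ν) • Φ

theorem paraxialOp_apply (ε ν kx ky : ℝ) (V : 𝓢'(ℝ × ℝ, ℂ)) (Φ : 𝓢(ℝ × ℝ, ℂ)) :
    paraxialOp ε ν kx ky V Φ = V (paraxialOpT ε ν kx ky Φ) := by
  have h : ∀ (a : ℝ × ℝ) (V : 𝓢'(ℝ × ℝ, ℂ)) (Φ : 𝓢(ℝ × ℝ, ℂ)), (∂_{a} V) Φ = -V (∂_{a} Φ) :=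
    fun a V Φ => by rw [TemperedDistribution.lineDerivOp_apply_apply, map_neg]
  have e : paraxialOp ε ν kx ky V Φ =
      Complex.I * (kx * (∂_{((1 : ℝ), (0 : ℝ))} V) Φ + ky * (∂_{((0 : ℝ), (1 : ℝ))} V) Φ)
      + (ε : ℂ) / 2 * (kx ^ 2 * (∂_{((0 : ℝ), (1 : ℝ))} (∂_{((0 : ℝ), (1 : ℝ))} V)) Φ
          - (2 * kx * ky) * (∂_{((1 : ℝ), (0 : ℝ))} (∂_{((0 : ℝ), (1 : ℝ))} V)) Φ
          + ky ^ 2 * (∂_{((1 : ℝ), (0 : ℝ))} (∂_{((1 : ℝ), (0 : ℝ))} V)) Φ)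
      + (Complex.I * ν) * V Φ := rfl
  rw [e]
  simp only [h, paraxialOpT, map_add, map_sub, map_neg, map_smul, smul_eq_mul]
  ring

theorem slice_eq_zero {Φ : 𝓢(ℝ × ℝ, ℂ)} {x : ℝ} (h : ∀ y, (x, y) ∉ tsupport Φ) :
    slice x Φ = 0 := by
  ext y
  exact image_eq_zero_of_notMem_tsupport (f := Φ) (h y)

end Evolve

theorem schwartzFourierInv_slice_right (x : ℝ) (Φ : 𝓢(ℝ × ℝ, ℂ)) :
    schwartzFourierInv (slice x (∂_{((0 : ℝ), (1 : ℝ))} Φ)) =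
      -SchwartzMap.smulLeftCLM ℂ iEta (schwartzFourierInv (slice x Φ)) := by
  rw [← derivCLM_slice, schwartzFourierInv_derivCLM]

theorem schwartzFourierInv_slice_paraxialOpT (ε ν kx ky x : ℝ) (Φ : 𝓢(ℝ × ℝ, ℂ)) (η : ℝ) :
    schwartzFourierInv (slice x (paraxialOpT ε ν kx ky Φ)) η =
      (ε * ky ^ 2 / 2) * schwartzFourierInv
          (slice x (∂_{((1 : ℝ), (0 : ℝ))} (∂_{((1 : ℝ), (0 : ℝ))} Φ))) η
        - symB ε kx ky η * schwartzFourierInv (slice x (∂_{((1 : ℝ), (0 : ℝ))} Φ)) η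
        + symC ε ν kx ky η * schwartzFourierInv (slice x Φ) η := by
  have e : schwartzFourierInv (slice x (paraxialOpT ε ν kx ky Φ)) η =
      -(Complex.I * (kx * schwartzFourierInv (slice x (∂_{((1 : ℝ), (0 : ℝ))} Φ)) η
        + ky * schwartzFourierInv (slice x (∂_{((0 : ℝ), (1 : ℝ))} Φ)) η))
      + (ε : ℂ) / 2 * (kx ^ 2 * schwartzFourierInv
            (slice x (∂_{((0 : ℝ), (1 : ℝ))} (∂_{((0 : ℝ), (1 : ℝ))} Φ))) η
          - (2 * kx * ky) * schwartzFourierInv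
            (slice x (∂_{((0 : ℝ), (1 : ℝ))} (∂_{((1 : ℝ), (0 : ℝ))} Φ))) η
          + ky ^ 2 * schwartzFourierInv
            (slice x (∂_{((1 : ℝ), (0 : ℝ))} (∂_{((1 : ℝ), (0 : ℝ))} Φ))) η)
      + (Complex.I * ν) * schwartzFourierInv (slice x Φ) η := by
    simp only [paraxialOpT, map_add, map_sub, map_neg, map_smul]
    rfl
  rw [e, schwartzFourierInv_slice_right, schwartzFourierInv_slice_right,
    schwartzFourierInv_slice_right, schwartzFourierInv_slice_right]
  simp only [map_neg, neg_apply, smulLeft_apply hasTemperateGrowth_iEta, iEta, symB, symC]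
  linear_combination ((ky * η : ℂ) + ε * kx ^ 2 * η ^ 2 / 2) * schwartzFourierInv (slice x Φ) η
    * Complex.I_sq

theorem integral_evolve_paraxialOpT {ε ν kx ky : ℝ} (hε : 0 < ε) (hν : 0 < ν) (hkx : 0 < kx)
    (hky : ky ≠ 0) (hk : kx ^ 2 + ky ^ 2 = 1) (G : 𝓢(ℝ, ℂ) →L[ℂ] ℂ) {Φ : 𝓢(ℝ × ℝ, ℂ)}
    (hΦ : HasCompactSupport Φ) (hΦ0 : tsupport Φ ⊆ {p : ℝ × ℝ | 0 < p.1}) :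
    ∫ x in Set.Ioi (0 : ℝ),
      evolve (Rminus ε ν kx ky) G x (slice x (paraxialOpT ε ν kx ky Φ)) = 0 := by
  set r := Rminus ε ν kx ky with hrdef
  set p := Rplus ε ν kx ky with hpdef
  have hr : r.HasTemperateGrowth := hasTemperateGrowth_Rminus hε hν hkx hky
  have hp : p.HasTemperateGrowth := hasTemperateGrowth_Rplus hε hν hkx hky
  have hre : ∀ η, (r η).re ≤ 0 := fun η => (Rminus_re_neg hε hν hkx hky η).le
  set Φ₁ := ∂_{((1 : ℝ), (0 : ℝ))} Φ with hΦ₁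
  have hΦ₁s : tsupport Φ₁ ⊆ tsupport Φ := SchwartzMap.tsupport_lineDerivOp_subset _ Φ
  set a : ℂ := ε * ky ^ 2 / 2 with ha
  set Gp := G.comp (SchwartzMap.smulLeftCLM ℂ p)
  let D : ℝ → ℂ := fun x => a * evolve r G x (slice x Φ₁) + a * evolve r Gp x (slice x Φ)
  have hD : ∀ x, 0 ≤ x → HasDerivWithinAt D
      (evolve r G x (slice x (paraxialOpT ε ν kx ky Φ))) (Set.Ici 0) x := by
    intro x hx
    refine (((hasDerivWithinAt_evolve_slice hr hre G hx Φ₁).const_mul a).add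
      ((hasDerivWithinAt_evolve_slice hr hre Gp hx Φ).const_mul a)).congr_deriv ?_
    have h1 : ∀ (c : ℂ) (ψ : 𝓢(ℝ, ℂ)), c * G ψ = G (c • ψ) := fun c ψ => by
      rw [map_smul, smul_eq_mul]
    simp only [evolve_apply, Gp, ContinuousLinearMap.comp_apply, h1, ← map_add]
    congr 1
    ext η
    simp only [add_apply, smul_apply, smul_eq_mul, mulExp_apply hr hre hx, smulLeft_apply hr,
      smulLeft_apply hp, schwartzFourierInv_slice_paraxialOpT]
    have h2 := Rminus_add_Rplus (ν := ν) (kx := kx) hε hky η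
    have h3 := Rminus_mul_Rplus (ν := ν) hε hkx hky hk η
    rw [← hrdef, ← hpdef, ← ha] at h2 h3
    rw [← ha, ← h3]
    linear_combination Complex.exp (r η * x) * schwartzFourierInv (slice x Φ₁) η * h2
  have hzero : ∀ x, (∀ y, (x, y) ∉ tsupport Φ) → D x = 0 := by
    intro x hx
    have h1 : slice x Φ = 0 := slice_eq_zero hx
    have h2 : slice x Φ₁ = 0 := slice_eq_zero fun y hy => hx y (hΦ₁s hy)
    simp only [D, h1, h2, map_zero, mul_zero, add_zero]
  have hD0 : D 0 = 0 := hzero 0 fun y hy => lt_irrefl (0 : ℝ) (hΦ0 hy)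
  obtain ⟨M, hM⟩ := hΦ.isBounded.exists_norm_le
  have hlim : Tendsto D atTop (𝓝 0) := by
    refine tendsto_const_nhds.congr' ?_
    filter_upwards [eventually_gt_atTop M] with x hx
    refine (hzero x fun y hy => ?_).symm
    have h1 : |x| ≤ ‖(x, y)‖ := le_max_left |x| |y|
    linarith [hM _ hy, le_abs_self x]
  have := integral_Ioi_of_hasDerivAt_of_tendsto (hD 0 le_rfl).continuousWithinAt
    (fun x hx => (hD x (le_of_lt hx)).hasDerivAt (Ici_mem_nhds hx))
    (integrableOn_evolve_slice hr hre G _) hlim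
  rw [this, hD0, sub_zero]

/-- The solution, as a function of `x ≥ 0`. -/
def solution (ε ν kx ky : ℝ) (g : 𝓢'(ℝ, ℂ)) (x : ℝ≥0) : 𝓢'(ℝ, ℂ) :=
  fourierYInv (TemperedDistribution.smulLeftCLM ℂ (propagator ε ν kx ky x) (fourierY g))

theorem fourierY_solution (ε ν kx ky : ℝ) (g : 𝓢'(ℝ, ℂ)) (x : ℝ≥0) :
    fourierY (solution ε ν kx ky g x) =
      TemperedDistribution.smulLeftCLM ℂ (propagator ε ν kx ky x) (fourierY g) :=
  fourierY_fourierYInv _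

/-- The Fourier transform of the datum, multiplied by the transmission factor. -/
def transmitted (ε ν kx ky : ℝ) (g : 𝓢'(ℝ, ℂ)) : 𝓢(ℝ, ℂ) →L[ℂ] ℂ :=
  ContinuousLinearMap.comp (fourierY g : 𝓢(ℝ, ℂ) →L[ℂ] ℂ)
    (SchwartzMap.smulLeftCLM ℂ (transmission ε ν kx ky))

section Solution

variable {ε ν kx ky : ℝ}

theorem smulLeft_propagator (hε : 0 < ε) (hν : 0 < ν) (hkx : 0 < kx) (hky : ky ≠ 0)
    (g : 𝓢'(ℝ, ℂ)) {x : ℝ} (hx : 0 ≤ x) (φ : 𝓢(ℝ, ℂ)) :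
    TemperedDistribution.smulLeftCLM ℂ (propagator ε ν kx ky x) (fourierY g) φ =
      transmitted ε ν kx ky g (mulExp (Rminus ε ν kx ky) x φ) := by
  rw [TemperedDistribution.smulLeftCLM_apply_apply]
  change fourierY g _ = fourierY g (SchwartzMap.smulLeftCLM ℂ (transmission ε ν kx ky)
    (mulExp (Rminus ε ν kx ky) x φ))
  congr 1
  ext η
  rw [smulLeft_apply (hasTemperateGrowth_propagator hε hν hkx hky hx),
    smulLeft_apply (hasTemperateGrowth_transmission hε hν hkx hky),
    mulExp_apply (hasTemperateGrowth_Rminus hε hν hkx hky)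
      (fun η => (Rminus_re_neg hε hν hkx hky η).le) hx, ← mul_assoc]
  rfl

theorem solution_apply (hε : 0 < ε) (hν : 0 < ν) (hkx : 0 < kx) (hky : ky ≠ 0)
    (g : 𝓢'(ℝ, ℂ)) (x : ℝ≥0) (ψ : 𝓢(ℝ, ℂ)) :
    solution ε ν kx ky g x ψ = evolve (Rminus ε ν kx ky) (transmitted ε ν kx ky g) x ψ :=
  smulLeft_propagator hε hν hkx hky g (NNReal.coe_nonneg x) _

theorem continuous_solution (hε : 0 < ε) (hν : 0 < ν) (hkx : 0 < kx) (hky : ky ≠ 0)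
    (g : 𝓢'(ℝ, ℂ)) : Continuous (solution ε ν kx ky g) := by
  refine PointwiseConvergenceCLM.continuous_of_continuous_eval fun ψ => ?_
  simp only [solution_apply hε hν hkx hky]
  have h : ContinuousOn (fun x : ℝ => evolve (Rminus ε ν kx ky) (transmitted ε ν kx ky g) x ψ)
      (Set.Ici 0) := fun x hx => (hasDerivWithinAt_evolve (hasTemperateGrowth_Rminus hε hν hkx hky)
        (fun η => (Rminus_re_neg hε hν hkx hky η).le) _ hx ψ).continuousWithinAt
  exact h.comp_continuous NNReal.continuous_coe NNReal.coe_nonneg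

theorem hasXDerivAt_of_fourierY_eq (hε : 0 < ε) (hν : 0 < ν) (hkx : 0 < kx) (hky : ky ≠ 0)
    {g : 𝓢'(ℝ, ℂ)} {u : ℝ≥0 → 𝓢'(ℝ, ℂ)}
    (hu : ∀ x : ℝ≥0, fourierY (u x) =
      TemperedDistribution.smulLeftCLM ℂ (propagator ε ν kx ky x) (fourierY g)) (x : ℝ≥0) :
    HasXDerivAt (fun t => fourierY (u t))
      (TemperedDistribution.smulLeftCLM ℂ (Rminus ε ν kx ky) (fourierY (u x))) x := by
  have hr := hasTemperateGrowth_Rminus hε hν hkx hky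
  have hre : ∀ η, (Rminus ε ν kx ky η).re ≤ 0 := fun η => (Rminus_re_neg hε hν hkx hky η).le
  intro φ
  have h := hasDerivWithinAt_clm_curve (transmitted ε ν kx ky g)
    (tendsto_slope_mulExp hr hre (NNReal.coe_nonneg x) φ)
  simp only [hu]
  rw [TemperedDistribution.smulLeftCLM_apply_apply, smulLeft_propagator hε hν hkx hky g (NNReal.coe_nonneg x)]
  refine h.congr (fun t ht => ?_) ?_
  · rw [← smulLeft_propagator hε hν hkx hky g ht, Real.coe_toNNReal t ht]
  · rw [← smulLeft_propagator hε hν hkx hky g (NNReal.coe_nonneg x), Real.toNNReal_coe]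

theorem HasXDerivAt.of_fourierY {u : ℝ≥0 → 𝓢'(ℝ, ℂ)} {w : 𝓢'(ℝ, ℂ)} {x : ℝ≥0}
    (h : HasXDerivAt (fun t => fourierY (u t)) w x) : HasXDerivAt u (fourierYInv w) x := by
  intro ψ
  simpa [fourierYInv_apply] using h (schwartzFourierInv ψ)

theorem smulLeft_zero_propagator (hε : 0 < ε) (hν : 0 < ν) (hkx : 0 < kx) (hky : ky ≠ 0)
    (g : 𝓢'(ℝ, ℂ)) (φ : 𝓢(ℝ, ℂ)) :
    TemperedDistribution.smulLeftCLM ℂ (propagator ε ν kx ky (0 : ℝ)) (fourierY g) φ =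
      fourierY g (SchwartzMap.smulLeftCLM ℂ (transmission ε ν kx ky) φ) := by
  rw [smulLeft_propagator hε hν hkx hky g le_rfl, mulExp_zero]
  rfl

theorem isSolution_solution (hε : 0 < ε) (hν : 0 < ν) (hkx : 0 < kx) (hky : ky ≠ 0)
    (hk : kx ^ 2 + ky ^ 2 = 1) (g : 𝓢'(ℝ, ℂ)) :
    IsSolution ε ν kx ky g ⟨solution ε ν kx ky g, continuous_solution hε hν hkx hky g⟩ := by
  have hr := hasTemperateGrowth_Rminus hε hν hkx hky
  have hre : ∀ η, (Rminus ε ν kx ky η).re ≤ 0 := fun η => (Rminus_re_neg hε hν hkx hky η).le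
  refine ⟨?_, ?_⟩
  · obtain ⟨V, hV⟩ := exists_zeroExtension hr hre (transmitted ε ν kx ky g)
    refine ⟨V, fun Φ _ => ?_, fun Φ hΦ hΦ0 => ?_⟩
    · refine (hV Φ).trans (setIntegral_congr_fun measurableSet_Ioi fun x hx => ?_)
      change _ = solution ε ν kx ky g x.toNNReal (slice x Φ)
      rw [solution_apply hε hν hkx hky, Real.coe_toNNReal x (le_of_lt hx)]
    · exact (paraxialOp_apply ε ν kx ky V Φ).trans
        ((hV _).trans (integral_evolve_paraxialOpT hε hν hkx hky hk _ hΦ hΦ0))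
  · have hF := fourierY_solution ε ν kx ky g
    refine ⟨_, (hasXDerivAt_of_fourierY_eq hε hν hkx hky hF 0).of_fourierY, ?_⟩
    refine fourierY_injective ?_
    ext φ
    have h0 : ∀ φ, fourierY (solution ε ν kx ky g 0) φ =
        fourierY g (SchwartzMap.smulLeftCLM ℂ (transmission ε ν kx ky) φ) := fun φ => by
      rw [hF 0]
      exact smulLeft_zero_propagator hε hν hkx hky g φ
    change (fourierY ((Complex.I * ε * ky) • ((kx : ℂ) • TemperedDistribution.derivCLM ℂ
      (solution ε ν kx ky g 0) - (ky : ℂ) • fourierYInv (TemperedDistribution.smulLeftCLM ℂ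
        (Rminus ε ν kx ky) (fourierY (solution ε ν kx ky g 0)))) + (2 * (kx : ℂ)) •
          solution ε ν kx ky g 0)) φ = fourierY ((2 * (kx : ℂ)) • g) φ
    simp only [map_add, map_sub, map_smul, fourierY_fourierYInv]
    change (Complex.I * ε * ky) * (kx * fourierY (TemperedDistribution.derivCLM ℂ
      (solution ε ν kx ky g 0)) φ - ky * (TemperedDistribution.smulLeftCLM ℂ
        (Rminus ε ν kx ky) (fourierY (solution ε ν kx ky g 0))) φ)
          + (2 * kx) * fourierY (solution ε ν kx ky g 0) φ = (2 * kx) * fourierY g φ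
    rw [fourierY_derivCLM, TemperedDistribution.smulLeftCLM_apply_apply, h0, h0, h0]
    have h1 : ∀ (c : ℂ) (ψ : 𝓢(ℝ, ℂ)), c * fourierY g ψ = fourierY g (c • ψ) := fun c ψ => by
      rw [map_smul, smul_eq_mul]
    simp only [h1, ← map_add, ← map_sub]
    congr 1
    ext η
    simp only [add_apply, sub_apply, smul_apply, smul_eq_mul, smulLeft_apply hr,
      smulLeft_apply hasTemperateGrowth_iEta, iEta,
      smulLeft_apply (hasTemperateGrowth_transmission hε hν hkx hky)]
    have h2 := boundary_symbol (ν := ν) (kx := kx) hε hky η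
    have h3 : transmission ε ν kx ky η * (1 + rootS ε ν kx ky η) = 2 :=
      div_mul_cancel₀ _ (one_add_rootS_ne_zero η)
    linear_combination transmission ε ν kx ky η * φ η * h2 + kx * φ η * h3

end Solution

/-! ### Uniqueness for the weak form of the ordinary differential equation -/

/-- Test functions on the open half-line. -/
structure IsTest (ρ : 𝓢(ℝ, ℂ)) : Prop where
  hasCompactSupport : HasCompactSupport ρ
  tsupport_subset : tsupport ρ ⊆ Set.Ioi 0

theorem IsTest.derivCLM {ρ : 𝓢(ℝ, ℂ)} (h : IsTest ρ) : IsTest (SchwartzMap.derivCLM ℂ ℂ ρ) :=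
  have hs := SchwartzMap.tsupport_derivCLM_subset ℂ ρ
  ⟨h.1.of_isClosed_subset (isClosed_tsupport _) hs, hs.trans h.2⟩

theorem hasCompactSupport_translate {ρ : 𝓢(ℝ, ℂ)} (h : HasCompactSupport ρ) (t : ℝ) :
    HasCompactSupport (SchwartzMap.compSubConstCLM ℂ t ρ) :=
  h.comp_homeomorph (Homeomorph.subRight t)

theorem IsTest.translate {ρ : 𝓢(ℝ, ℂ)} (h : IsTest ρ) {t : ℝ} (ht : 0 ≤ t) :
    IsTest (SchwartzMap.compSubConstCLM ℂ t ρ) := by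
  refine ⟨hasCompactSupport_translate h.1 t, fun x hx => ?_⟩
  have h1 : x - t ∈ tsupport ρ :=
    tsupport_comp_subset_preimage ρ (f := fun x => x - t) (by fun_prop) hx
  have h2 : 0 < x - t := h.2 h1
  exact lt_of_le_of_lt ht (sub_pos.1 h2)

/-- The average `∫ ρ(x) ⟨T_x, φ⟩ dx` of a curve of functionals. -/
def smear (T : ℝ → 𝓢(ℝ, ℂ) →L[ℂ] ℂ) (ρ φ : 𝓢(ℝ, ℂ)) : ℂ := ∫ x, ρ x * T x φ

section Smear

variable {T : ℝ → 𝓢(ℝ, ℂ) →L[ℂ] ℂ}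

theorem integrable_smear (hT : ∀ φ, Continuous fun x => T x φ) {ρ : 𝓢(ℝ, ℂ)}
    (hρ : HasCompactSupport ρ) (φ : 𝓢(ℝ, ℂ)) : Integrable fun x => ρ x * T x φ :=
  (ρ.continuous.mul (hT φ)).integrable_of_hasCompactSupport hρ.mul_right

/-- `smear`, as a linear map. -/
def smearLM (hT : ∀ φ, Continuous fun x => T x φ) {ρ : 𝓢(ℝ, ℂ)} (hρ : HasCompactSupport ρ) :
    𝓢(ℝ, ℂ) →ₗ[ℂ] ℂ where
  toFun := smear T ρ
  map_add' φ ψ := by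
    rw [smear, smear, smear, ← integral_add (integrable_smear hT hρ φ) (integrable_smear hT hρ ψ)]
    simp only [map_add, mul_add]
  map_smul' c φ := by
    rw [smear, smear, RingHom.id_apply, ← integral_smul]
    refine integral_congr_ae (Eventually.of_forall fun x => ?_)
    simp only [map_smul, smul_eq_mul]
    ring

theorem smearLM_apply (hT : ∀ φ, Continuous fun x => T x φ) {ρ : 𝓢(ℝ, ℂ)}
    (hρ : HasCompactSupport ρ) (φ : 𝓢(ℝ, ℂ)) : smearLM hT hρ φ = smear T ρ φ := rfl

theorem smear_add (hT : ∀ φ, Continuous fun x => T x φ) {ρ : 𝓢(ℝ, ℂ)}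
    (hρ : HasCompactSupport ρ) (φ ψ : 𝓢(ℝ, ℂ)) :
    smear T ρ (φ + ψ) = smear T ρ φ + smear T ρ ψ :=
  map_add (smearLM hT hρ) φ ψ

theorem smear_neg (hT : ∀ φ, Continuous fun x => T x φ) {ρ : 𝓢(ℝ, ℂ)}
    (hρ : HasCompactSupport ρ) (φ : 𝓢(ℝ, ℂ)) : smear T ρ (-φ) = -smear T ρ φ :=
  map_neg (smearLM hT hρ) φ

theorem smear_smul (hT : ∀ φ, Continuous fun x => T x φ) {ρ : 𝓢(ℝ, ℂ)}
    (hρ : HasCompactSupport ρ) (c : ℂ) (φ : 𝓢(ℝ, ℂ)) : smear T ρ (c • φ) = c * smear T ρ φ :=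
  map_smul (smearLM hT hρ) c φ

theorem hasDerivAt_smear (hT : ∀ φ, Continuous fun x => T x φ) {ρ : 𝓢(ℝ, ℂ)}
    (hρ : HasCompactSupport ρ) (φ : 𝓢(ℝ, ℂ)) (t : ℝ) :
    HasDerivAt (fun t => smear T (SchwartzMap.compSubConstCLM ℂ t ρ) φ)
      (-smear T (SchwartzMap.compSubConstCLM ℂ t (SchwartzMap.derivCLM ℂ ℂ ρ)) φ) t := by
  have h1 : HasCompactSupport fun s => ρ (-s) := hρ.comp_homeomorph (Homeomorph.neg ℝ)
  have h2 : ContDiff ℝ 1 fun s => ρ (-s) := (ρ.smooth 1).comp contDiff_neg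
  have h3 := h1.hasDerivAt_convolution_left (ContinuousLinearMap.mul ℝ ℂ) (μ := volume) h2
    (hT φ).locallyIntegrable t
  have e1 : (fun t => smear T (SchwartzMap.compSubConstCLM ℂ t ρ) φ) =
      convolution (fun s => ρ (-s)) (fun x => T x φ) (ContinuousLinearMap.mul ℝ ℂ) volume := by
    funext t
    rw [convolution_eq_swap]
    simp only [neg_sub, smear, SchwartzMap.compSubConstCLM_apply, ContinuousLinearMap.mul_apply']
  have e2 : deriv (fun s => ρ (-s)) = fun s => -SchwartzMap.derivCLM ℂ ℂ ρ (-s) := by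
    funext s
    rw [SchwartzMap.derivCLM_apply]
    have h4 : HasDerivAt (fun s => ρ (-s)) ((-1 : ℝ) • deriv ρ (-s)) s :=
      (ρ.hasDerivAt (-s)).scomp s (hasDerivAt_neg s)
    rw [h4.deriv, neg_one_smul]
  rw [e1]
  refine h3.congr_deriv ?_
  rw [convolution_eq_swap, e2, smear, ← integral_neg]
  refine integral_congr_ae (Eventually.of_forall fun x => ?_)
  simp only [neg_sub, SchwartzMap.compSubConstCLM_apply, ContinuousLinearMap.mul_apply', neg_mul]

theorem tendsto_slope_reflect {c : ℝ → 𝓢(ℝ, ℂ)} {c' : 𝓢(ℝ, ℂ)} {t s : ℝ}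
    (hc : Tendsto (slope c (t - s)) (𝓝[Set.Ici 0 \ {t - s}] (t - s)) (𝓝 c')) :
    Tendsto (slope (fun s => c (t - s)) s) (𝓝[Set.Icc 0 t \ {s}] s) (𝓝 (-c')) := by
  have h1 : Tendsto (fun x => t - x) (𝓝[Set.Icc 0 t \ {s}] s)
      (𝓝[Set.Ici 0 \ {t - s}] (t - s)) := by
    refine tendsto_nhdsWithin_of_tendsto_nhds_of_eventually_within _
      (((by fun_prop : Continuous fun x : ℝ => t - x).tendsto s).mono_left nhdsWithin_le_nhds) ?_
    filter_upwards [self_mem_nhdsWithin] with x hx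
    refine ⟨sub_nonneg.2 hx.1.2, fun h => hx.2 ?_⟩
    have : t - x = t - s := h
    rw [Set.mem_singleton_iff]
    linarith
  refine ((hc.comp h1).neg).congr fun x => ?_
  rw [Function.comp_apply, slope_def_module, slope_def_module, ← neg_smul, ← inv_neg]
  congr 2
  ring

theorem eq_of_hasDerivWithinAt_zero {F : ℝ → ℂ} {S : Set ℝ} (hS : Convex ℝ S)
    (hF : ∀ x ∈ S, HasDerivWithinAt F 0 S x) {x y : ℝ} (hx : x ∈ S) (hy : y ∈ S) : F x = F y := by
  have := hS.norm_image_sub_le_of_norm_hasDerivWithin_le (C := 0) hF (fun x _ => by simp) hy hx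
  rw [zero_mul, norm_le_zero_iff, sub_eq_zero] at this
  exact this

theorem eq_zero_of_forall_integral_eq_zero {F : ℝ → ℂ} (hF : Continuous F)
    (h : ∀ ρ, IsTest ρ → ∫ x, ρ x * F x = 0) : ∀ x, 0 ≤ x → F x = 0 := by
  have hae : ∀ᵐ x ∂(volume : Measure ℝ), x ∈ Set.Ioi (0 : ℝ) → F x = 0 := by
    refine isOpen_Ioi.ae_eq_zero_of_integral_contDiff_smul_eq_zero
      (hF.locallyIntegrable.locallyIntegrableOn _) fun f hf hfc hfs => ?_
    have hc : HasCompactSupport fun x => ((f x : ℝ) : ℂ) := hfc.comp_left Complex.ofReal_zero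
    obtain ⟨ρ, hρ⟩ : ∃ ρ : 𝓢(ℝ, ℂ), (ρ : ℝ → ℂ) = fun x => ((f x : ℝ) : ℂ) :=
      ⟨hc.toSchwartzMap (Complex.ofRealCLM.contDiff.comp hf), rfl⟩
    have h1 := h ρ ⟨hρ ▸ hc, by
      rw [hρ]
      exact (tsupport_comp_subset Complex.ofReal_zero f).trans hfs⟩
    rw [hρ] at h1
    simpa only [Complex.real_smul] using h1
  have hon := Measure.eqOn_open_of_ae_eq (μ := (volume : Measure ℝ)) (g := fun _ => (0 : ℂ))
    ((ae_restrict_iff' measurableSet_Ioi).2 hae) isOpen_Ioi hF.continuousOn continuousOn_const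
  have h0 := hon.closure hF continuous_const
  rw [closure_Ioi] at h0
  exact fun x hx => h0 hx

variable {r p : ℝ → ℂ}

/-- If `(∂_x - r)(∂_x - p) T = 0` in the weak sense, with `Re p > 0`, and the averages of `T` grow
at most polynomially, then `(∂_x - r) T = 0` in the weak sense. -/
theorem smear_derivCLM_add_eq_zero
    (hp : p.HasTemperateGrowth) (hpre : ∀ x, 0 ≤ (p x).re) {K : ℕ} {D : ℝ}
    (hD : ∀ x, 1 ≤ D * (1 + |x|) ^ K * (p x).re) (hT : ∀ φ, Continuous fun x => T x φ)
    (hEq : ∀ ρ, IsTest ρ → ∀ φ,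
      smear T (SchwartzMap.derivCLM ℂ ℂ (SchwartzMap.derivCLM ℂ ℂ ρ)) φ
        + smear T (SchwartzMap.derivCLM ℂ ℂ ρ)
            (SchwartzMap.smulLeftCLM ℂ r φ + SchwartzMap.smulLeftCLM ℂ p φ)
        + smear T ρ (SchwartzMap.smulLeftCLM ℂ r (SchwartzMap.smulLeftCLM ℂ p φ)) = 0)
    (hB : ∀ ρ, IsTest ρ → ∃ (N : ℕ) (q : Seminorm ℂ 𝓢(ℝ, ℂ)), Continuous q ∧
      ∀ t : ℝ, 0 ≤ t → ∀ φ, ‖smear T (SchwartzMap.compSubConstCLM ℂ t ρ) φ‖ ≤ (1 + t) ^ N * q φ)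
    {ρ : 𝓢(ℝ, ℂ)} (hρ : IsTest ρ) (φ : 𝓢(ℝ, ℂ)) :
    smear T (SchwartzMap.derivCLM ℂ ℂ ρ) φ + smear T ρ (SchwartzMap.smulLeftCLM ℂ r φ) = 0 := by
  have hn : (-p).HasTemperateGrowth := hp.neg
  have hnre : ∀ x, ((-p) x).re ≤ 0 := fun x => by simpa using hpre x
  have hnD : ∀ x, 1 ≤ D * (1 + |x|) ^ K * (-((-p) x).re) := fun x => by simpa using hD x
  set ρ' := SchwartzMap.derivCLM ℂ ℂ ρ with hρ'
  set τ : ℝ → 𝓢(ℝ, ℂ) → 𝓢(ℝ, ℂ) := fun t ρ => SchwartzMap.compSubConstCLM ℂ t ρ with hτ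
  let R : 𝓢(ℝ, ℂ) →L[ℂ] 𝓢(ℝ, ℂ) := SchwartzMap.smulLeftCLM ℂ r
  let Z : ℝ → 𝓢(ℝ, ℂ) →ₗ[ℂ] ℂ := fun t =>
    smearLM hT (hasCompactSupport_translate hρ.derivCLM.1 t)
      + (smearLM hT (hasCompactSupport_translate hρ.1 t)).comp R.toLinearMap
  have hZ : ∀ t φ, Z t φ = smear T (τ t ρ') φ + smear T (τ t ρ) (R φ) := fun _ _ => rfl
  obtain ⟨N₁, q₁, hq₁, hb₁⟩ := hB ρ' hρ.derivCLM
  obtain ⟨N₂, q₂, hq₂, hb₂⟩ := hB ρ hρ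
  set q := q₁ + q₂.comp R.toLinearMap
  have hq : Continuous q := hq₁.add (hq₂.comp R.continuous)
  have hbound : ∀ t, 0 ≤ t → ∀ φ, ‖Z t φ‖ ≤ (1 + t) ^ (N₁ + N₂) * q φ := by
    intro t ht φ
    have h0 : (1 : ℝ) ≤ 1 + t := by linarith
    have h1 : (1 + t) ^ N₁ ≤ (1 + t) ^ (N₁ + N₂) := pow_le_pow_right₀ h0 (Nat.le_add_right _ _)
    have h2 : (1 + t) ^ N₂ ≤ (1 + t) ^ (N₁ + N₂) := pow_le_pow_right₀ h0 (Nat.le_add_left _ _)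
    have h3 : q φ = q₁ φ + q₂ (R φ) := rfl
    rw [hZ, h3, mul_add]
    refine (norm_add_le _ _).trans (add_le_add ((hb₁ t ht φ).trans ?_) ((hb₂ t ht _).trans ?_))
    · gcongr
    · gcongr
  have hZd : ∀ t, 0 ≤ t → ∀ φ, HasDerivAt (fun t => Z t φ) (Z t (SchwartzMap.smulLeftCLM ℂ p φ)) t := by
    intro t ht φ
    refine ((hasDerivAt_smear hT hρ.derivCLM.1 φ t).add
      (hasDerivAt_smear hT hρ.1 (R φ) t)).congr_deriv ?_
    have h1 := hEq _ (hρ.translate ht) φ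
    simp only [derivCLM_compSubConstCLM] at h1
    rw [smear_add hT (hasCompactSupport_translate hρ.derivCLM.1 t)] at h1
    change -smear T (τ t (SchwartzMap.derivCLM ℂ ℂ ρ')) φ + -smear T (τ t ρ') (R φ) =
      smear T (τ t ρ') (SchwartzMap.smulLeftCLM ℂ p φ)
        + smear T (τ t ρ) (R (SchwartzMap.smulLeftCLM ℂ p φ))
    linear_combination -h1
  have hF : ∀ t ∈ Set.Ici (0 : ℝ),
      HasDerivWithinAt (fun s => Z s (mulExp (-p) s φ)) 0 (Set.Ici 0) t := by
    intro t ht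
    have ht0 : (0 : ℝ) ≤ t := ht
    obtain ⟨Q, hQ, hQe⟩ : ∃ Q : Seminorm ℂ 𝓢(ℝ, ℂ), Continuous Q ∧
        ∀ ψ, Q ψ = (2 + t) ^ (N₁ + N₂) * q ψ :=
      exists_seminorm_eq_mul hq (by positivity)
    refine (hasDerivWithinAt_apply_curve (T := Z) hQ ?_ ?_ (hZd t ht _).hasDerivWithinAt
      (tendsto_slope_mulExp hn hnre ht φ)).congr_deriv ?_
    · filter_upwards [self_mem_nhdsWithin,
        mem_nhdsWithin_of_mem_nhds (Iio_mem_nhds (lt_add_one t))] with s hs hs1 ψ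
      refine (hbound s hs ψ).trans ?_
      rw [hQe]
      have h0 : (0 : ℝ) ≤ s := hs
      have h1 : s < t + 1 := hs1
      exact mul_le_mul_of_nonneg_right (pow_le_pow_left₀ (by linarith) (by linarith) _)
        (apply_nonneg q ψ)
    · exact (hZd t ht _).continuousAt.continuousWithinAt
    · rw [← map_add, mulExp_comm hn hnre ht hn, ← map_zero (Z t)]
      congr 1
      ext x
      simp [smulLeft_apply hp, smulLeft_apply hn]
  have hlim : Tendsto (fun s => Z s (mulExp (-p) s φ)) atTop (𝓝 0) := by
    have h1 := (hq.tendsto 0).comp (tendsto_pow_mul_mulExp hn hnre hnD (N₁ + N₂) φ)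
    rw [map_zero] at h1
    refine squeeze_zero_norm' ?_ h1
    filter_upwards [eventually_ge_atTop 0] with s hs
    refine (hbound s hs _).trans (le_of_eq ?_)
    rw [Function.comp_apply, map_smul_eq_mul, norm_pow, Complex.norm_real,
      Real.norm_of_nonneg (by linarith)]
  have hconst : Tendsto (fun s => Z s (mulExp (-p) s φ)) atTop (𝓝 (Z 0 (mulExp (-p) 0 φ))) := by
    refine tendsto_const_nhds.congr' ?_
    filter_upwards [eventually_ge_atTop 0] with s hs
    exact eq_of_hasDerivWithinAt_zero (F := fun s => Z s (mulExp (-p) s φ)) (convex_Ici 0) hF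
      (Set.mem_Ici.2 le_rfl) hs
  have h0 := tendsto_nhds_unique hconst hlim
  rw [mulExp_zero, hZ] at h0
  simpa [hτ, R] using h0

/-- If `(∂_x - r) T = 0` in the weak sense on the open half-line, then `T_x = e^{r x} T_0`. -/
theorem eq_mulExp_of_smear (hr : r.HasTemperateGrowth) (hre : ∀ x, (r x).re ≤ 0)
    (hT : ∀ φ, Continuous fun x => T x φ)
    (hB : ∀ ρ, IsTest ρ → ∃ (N : ℕ) (q : Seminorm ℂ 𝓢(ℝ, ℂ)), Continuous q ∧
      ∀ t : ℝ, 0 ≤ t → ∀ φ, ‖smear T (SchwartzMap.compSubConstCLM ℂ t ρ) φ‖ ≤ (1 + t) ^ N * q φ)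
    (h : ∀ ρ, IsTest ρ → ∀ φ,
      smear T (SchwartzMap.derivCLM ℂ ℂ ρ) φ + smear T ρ (SchwartzMap.smulLeftCLM ℂ r φ) = 0)
    {t : ℝ} (ht : 0 ≤ t) (φ : 𝓢(ℝ, ℂ)) : T t φ = T 0 (mulExp r t φ) := by
  have key : ∀ ρ, IsTest ρ →
      smear T (SchwartzMap.compSubConstCLM ℂ t ρ) φ = smear T ρ (mulExp r t φ) := by
    intro ρ hρ
    let J : ℝ → 𝓢(ℝ, ℂ) →ₗ[ℂ] ℂ := fun s => smearLM hT (hasCompactSupport_translate hρ.1 s)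
    have hJ : ∀ s ψ, J s ψ = smear T (SchwartzMap.compSubConstCLM ℂ s ρ) ψ := fun _ _ => rfl
    have hJd : ∀ s, 0 ≤ s → ∀ ψ,
        HasDerivAt (fun s => J s ψ) (J s (SchwartzMap.smulLeftCLM ℂ r ψ)) s := by
      intro s hs ψ
      refine (hasDerivAt_smear hT hρ.1 ψ s).congr_deriv ?_
      have h1 := h _ (hρ.translate hs) ψ
      rw [derivCLM_compSubConstCLM] at h1
      rw [hJ]
      linear_combination -h1
    obtain ⟨N, q, hq, hb⟩ := hB ρ hρ
    obtain ⟨Q, hQ, hQe⟩ : ∃ Q : Seminorm ℂ 𝓢(ℝ, ℂ), Continuous Q ∧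
        ∀ ψ, Q ψ = (1 + t) ^ N * q ψ :=
      exists_seminorm_eq_mul hq (by positivity)
    have hF : ∀ s ∈ Set.Icc 0 t,
        HasDerivWithinAt (fun s => J s (mulExp r (t - s) φ)) 0 (Set.Icc 0 t) s := by
      intro s hs
      have hts : 0 ≤ t - s := sub_nonneg.2 hs.2
      refine (hasDerivWithinAt_apply_curve (T := J) hQ ?_ ?_ (hJd s hs.1 _).hasDerivWithinAt
        (tendsto_slope_reflect (tendsto_slope_mulExp hr hre hts φ))).congr_deriv ?_
      · filter_upwards [self_mem_nhdsWithin] with x hx ψ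
        refine (hb x hx.1 ψ).trans ?_
        rw [hQe]
        exact mul_le_mul_of_nonneg_right (pow_le_pow_left₀ (by linarith [hx.1])
          (by linarith [hx.2]) _) (apply_nonneg q ψ)
      · exact (hJd s hs.1 _).continuousAt.continuousWithinAt
      · rw [map_neg, mulExp_comm hr hre hts hr, add_neg_cancel]
    have h2 := eq_of_hasDerivWithinAt_zero (F := fun s => J s (mulExp r (t - s) φ))
      (convex_Icc 0 t) hF (Set.right_mem_Icc.2 ht) (Set.left_mem_Icc.2 ht)
    simpa [hJ, mulExp_zero] using h2
  have hc₁ : Continuous fun x => T (x + t) φ := (hT φ).comp (continuous_add_const t)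
  have h0 := eq_zero_of_forall_integral_eq_zero (F := fun x => T (x + t) φ - T x (mulExp r t φ))
    (hc₁.sub (hT (mulExp r t φ))) (fun ρ hρ => ?_) 0 le_rfl
  · rwa [zero_add, sub_eq_zero] at h0
  · have h1 := key ρ hρ
    have h2 : smear T (SchwartzMap.compSubConstCLM ℂ t ρ) φ = ∫ x, ρ x * T (x + t) φ := by
      rw [smear, ← integral_add_right_eq_self _ t]
      simp only [SchwartzMap.compSubConstCLM_apply, add_sub_cancel_right]
    have hi : Integrable fun x => ρ x * T (x + t) φ :=
      (ρ.continuous.mul hc₁).integrable_of_hasCompactSupport hρ.1.mul_right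
    rw [h2, smear, ← sub_eq_zero, ← integral_sub hi (integrable_smear hT hρ.1 _)] at h1
    simpa only [mul_sub] using h1

end Smear

/-! ### Uniqueness -/

theorem continuous_of_norm_le_seminorm {f : 𝓢(ℝ, ℂ) →ₗ[ℂ] ℂ} {q : Seminorm ℂ 𝓢(ℝ, ℂ)}
    (hq : Continuous q) (h : ∀ φ, ‖f φ‖ ≤ q φ) : Continuous f := by
  refine continuous_of_continuousAt_zero f ?_
  rw [ContinuousAt, map_zero]
  refine squeeze_zero_norm h ?_
  have := hq.tendsto 0
  rwa [map_zero] at this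

theorem continuous_smear {T : ℝ → 𝓢(ℝ, ℂ) →L[ℂ] ℂ} (hT : ∀ φ, Continuous fun x => T x φ)
    {ρ : 𝓢(ℝ, ℂ)} (hρ : HasCompactSupport ρ) : Continuous (smear T ρ) := by
  obtain ⟨q, hq, hb⟩ := exists_seminorm_bound_of_pointwise (fun x : tsupport ρ => T x) fun φ => by
    obtain ⟨C, hC⟩ := hρ.isCompact.exists_bound_of_continuousOn (hT φ).continuousOn
    exact ⟨C, fun x => hC x x.2⟩
  have hi : Integrable fun x => ‖ρ x‖ := ρ.integrable.norm
  obtain ⟨Q, hQ, hQe⟩ : ∃ Q : Seminorm ℂ 𝓢(ℝ, ℂ), Continuous Q ∧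
      ∀ ψ, Q ψ = (∫ x, ‖ρ x‖) * q ψ :=
    exists_seminorm_eq_mul hq (integral_nonneg fun x => norm_nonneg _)
  refine continuous_of_norm_le_seminorm (f := smearLM hT hρ) hQ fun φ => ?_
  rw [smearLM_apply, hQe, ← integral_mul_const]
  refine norm_integral_le_of_norm_le (hi.mul_const _) (Eventually.of_forall fun x => ?_)
  rw [norm_mul]
  by_cases hx : x ∈ tsupport ρ
  · exact mul_le_mul_of_nonneg_left (hb ⟨x, hx⟩ φ) (norm_nonneg _)
  · rw [image_eq_zero_of_notMem_tsupport hx]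
    simp

theorem IsZeroExtension.apply_tensor {u : ℝ≥0 → 𝓢'(ℝ, ℂ)} {V : 𝓢'(ℝ × ℝ, ℂ)}
    (hV : IsZeroExtension u V) (hu : Continuous u) {ρ : 𝓢(ℝ, ℂ)} (hρ : IsTest ρ) (ψ : 𝓢(ℝ, ℂ)) :
    V (tensor ρ ψ) = smear (fun x => (u x.toNNReal : 𝓢(ℝ, ℂ) →L[ℂ] ℂ)) ρ ψ := by
  have hT : ∀ φ : 𝓢(ℝ, ℂ), Continuous fun x : ℝ => u x.toNNReal φ := fun φ =>
    (PointwiseConvergenceCLM.evalCLM (RingHom.id ℂ) ℂ φ).continuous.comp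
      (hu.comp continuous_real_toNNReal)
  refine eq_of_eq_on_hasCompactSupport (F := fun ψ => V (tensor ρ ψ))
    (V.continuous.comp (tensor ρ).continuous) (continuous_smear hT hρ.1) (fun φ hφ => ?_) ψ
  rw [hV _ (hasCompactSupport_tensor hρ.1 hφ)]
  change _ = ∫ x, ρ x * u x.toNNReal φ
  simp only [slice_tensor, map_smul, smul_eq_mul]
  refine setIntegral_eq_integral_of_forall_compl_eq_zero fun x hx => ?_
  rw [image_eq_zero_of_notMem_tsupport fun h => hx (hρ.2 h), zero_mul]

theorem paraxialOpT_tensor (ε ν kx ky : ℝ) (ρ φ : 𝓢(ℝ, ℂ)) :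
    paraxialOpT ε ν kx ky (tensor ρ (schwartzFourier φ)) =
      tensor (SchwartzMap.derivCLM ℂ ℂ (SchwartzMap.derivCLM ℂ ℂ ρ))
          (schwartzFourier (((ε * ky ^ 2 / 2 : ℂ)) • φ))
        - tensor (SchwartzMap.derivCLM ℂ ℂ ρ)
          (schwartzFourier (SchwartzMap.smulLeftCLM ℂ (symB ε kx ky) φ))
        + tensor ρ (schwartzFourier (SchwartzMap.smulLeftCLM ℂ (symC ε ν kx ky) φ)) := by
  have hB : SchwartzMap.smulLeftCLM ℂ (symB ε kx ky) φ =
      (Complex.I * kx) • φ - (ε * kx * ky : ℂ) • SchwartzMap.smulLeftCLM ℂ iEta φ := by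
    ext η
    simp only [sub_apply, smul_apply, smul_eq_mul, smulLeft_apply hasTemperateGrowth_symB,
      smulLeft_apply hasTemperateGrowth_iEta, symB, iEta]
    ring
  have hC : SchwartzMap.smulLeftCLM ℂ (symC ε ν kx ky) φ =
      (Complex.I * ky) • SchwartzMap.smulLeftCLM ℂ iEta φ
        + (ε * kx ^ 2 / 2 : ℂ) • SchwartzMap.smulLeftCLM ℂ iEta (SchwartzMap.smulLeftCLM ℂ iEta φ)
        + (Complex.I * ν) • φ := by
    ext η
    simp only [add_apply, smul_apply, smul_eq_mul, smulLeft_apply hasTemperateGrowth_symC,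
      smulLeft_apply hasTemperateGrowth_iEta, symC, iEta]
    linear_combination (-(ky * η : ℂ) - ε * kx ^ 2 * η ^ 2 / 2) * φ η * Complex.I_sq
  rw [hB, hC, paraxialOpT]
  simp only [lineDerivOp_left_tensor, lineDerivOp_right_tensor]
  simp only [derivCLM_schwartzFourier, map_neg, map_add, map_sub, map_smul]
  module

section Uniqueness

variable {ε ν kx ky : ℝ}

theorem IsSolution.fourierY_apply_eq (hε : 0 < ε) (hν : 0 < ν) (hkx : 0 < kx) (hky : ky ≠ 0)
    (hk : kx ^ 2 + ky ^ 2 = 1) {g : 𝓢'(ℝ, ℂ)} {u : C(ℝ≥0, 𝓢'(ℝ, ℂ))}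
    (hu : IsSolution ε ν kx ky g u) {x : ℝ} (hx : 0 ≤ x) (φ : 𝓢(ℝ, ℂ)) :
    fourierY (u x.toNNReal) φ = fourierY (u 0) (mulExp (Rminus ε ν kx ky) x φ) := by
  obtain ⟨V, hV, hVeq⟩ := hu.equation
  have hr := hasTemperateGrowth_Rminus hε hν hkx hky
  have hp := hasTemperateGrowth_Rplus hε hν hkx hky
  have hre : ∀ η, (Rminus ε ν kx ky η).re ≤ 0 := fun η => (Rminus_re_neg hε hν hkx hky η).le
  have hpre : ∀ η, 0 ≤ (Rplus ε ν kx ky η).re := fun η => (Rplus_re_pos hε hν hkx hky η).le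
  obtain ⟨K, D, hD⟩ := exists_one_le_mul_Rplus_re hε hν hkx hky
  let T : ℝ → 𝓢(ℝ, ℂ) →L[ℂ] ℂ := fun x => (fourierY (u x.toNNReal) : 𝓢(ℝ, ℂ) →L[ℂ] ℂ)
  have hT : ∀ φ, Continuous fun x => T x φ := fun φ =>
    (PointwiseConvergenceCLM.evalCLM (RingHom.id ℂ) ℂ (schwartzFourier φ)).continuous.comp
      (u.continuous.comp continuous_real_toNNReal)
  have hVT : ∀ ρ, IsTest ρ → ∀ φ, V (tensor ρ (schwartzFourier φ)) = smear T ρ φ :=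
    fun ρ hρ φ => hV.apply_tensor u.continuous hρ _
  have hB : ∀ ρ, IsTest ρ → ∃ (N : ℕ) (q : Seminorm ℂ 𝓢(ℝ, ℂ)), Continuous q ∧
      ∀ t : ℝ, 0 ≤ t → ∀ φ,
        ‖smear T (SchwartzMap.compSubConstCLM ℂ t ρ) φ‖ ≤ (1 + t) ^ N * q φ := by
    intro ρ hρ
    obtain ⟨N, q, hq, hb⟩ := exists_norm_apply_tensor_translate_le V ρ
    refine ⟨N, q.comp schwartzFourier.toLinearMap, hq.comp schwartzFourier.continuous,
      fun t ht φ => ?_⟩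
    rw [← hVT _ (hρ.translate ht)]
    exact hb t ht _
  have hzero : ∀ ρ, IsTest ρ → ∀ ψ, paraxialOp ε ν kx ky V (tensor ρ ψ) = 0 := by
    intro ρ hρ ψ
    refine eq_of_eq_on_hasCompactSupport (F := fun ψ => paraxialOp ε ν kx ky V (tensor ρ ψ))
      ((paraxialOp ε ν kx ky V).continuous.comp (tensor ρ).continuous) continuous_const
      (fun ψ hψ => hVeq _ (hasCompactSupport_tensor hρ.1 hψ) fun p hp => ?_) ψ
    exact hρ.2 (tsupport_tensor_subset ρ ψ hp).1
  have hEq : ∀ ρ, IsTest ρ → ∀ φ,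
      smear T (SchwartzMap.derivCLM ℂ ℂ (SchwartzMap.derivCLM ℂ ℂ ρ)) φ
        + smear T (SchwartzMap.derivCLM ℂ ℂ ρ) (SchwartzMap.smulLeftCLM ℂ (Rminus ε ν kx ky) φ
            + SchwartzMap.smulLeftCLM ℂ (Rplus ε ν kx ky) φ)
        + smear T ρ (SchwartzMap.smulLeftCLM ℂ (Rminus ε ν kx ky)
            (SchwartzMap.smulLeftCLM ℂ (Rplus ε ν kx ky) φ)) = 0 := by
    intro ρ hρ φ
    set a : ℂ := ε * ky ^ 2 / 2 with ha
    have ha0 : a ≠ 0 := by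
      have h1 : (ε : ℂ) ≠ 0 := by exact_mod_cast hε.ne'
      have h2 : (ky : ℂ) ≠ 0 := by exact_mod_cast hky
      exact div_ne_zero (mul_ne_zero h1 (pow_ne_zero 2 h2)) two_ne_zero
    have h1 := hzero ρ hρ (schwartzFourier φ)
    rw [paraxialOp_apply, paraxialOpT_tensor] at h1
    have eB : SchwartzMap.smulLeftCLM ℂ (symB ε kx ky) φ =
        -(a • (SchwartzMap.smulLeftCLM ℂ (Rminus ε ν kx ky) φ
          + SchwartzMap.smulLeftCLM ℂ (Rplus ε ν kx ky) φ)) := by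
      ext η
      simp only [neg_apply, add_apply, smul_apply, smul_eq_mul,
        smulLeft_apply hasTemperateGrowth_symB, smulLeft_apply hr, smulLeft_apply hp]
      linear_combination φ η * Rminus_add_Rplus (ν := ν) (kx := kx) hε hky η
    have eC : SchwartzMap.smulLeftCLM ℂ (symC ε ν kx ky) φ =
        a • SchwartzMap.smulLeftCLM ℂ (Rminus ε ν kx ky)
          (SchwartzMap.smulLeftCLM ℂ (Rplus ε ν kx ky) φ) := by
      ext η
      simp only [smul_apply, smul_eq_mul, smulLeft_apply hasTemperateGrowth_symC,
        smulLeft_apply hr, smulLeft_apply hp]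
      linear_combination -φ η * Rminus_mul_Rplus (ν := ν) hε hkx hky hk η
    rw [eB, eC, map_add, map_sub, hVT _ hρ.derivCLM.derivCLM, hVT _ hρ.derivCLM, hVT _ hρ,
      smear_neg hT hρ.derivCLM.1, smear_smul hT hρ.derivCLM.1, smear_smul hT hρ.1,
      smear_smul hT hρ.derivCLM.derivCLM.1] at h1
    refine (mul_eq_zero.1 ?_).resolve_left ha0
    linear_combination h1
  have h := eq_mulExp_of_smear hr hre hT hB
    (fun ρ hρ φ => smear_derivCLM_add_eq_zero hp hpre hD hT hEq hB hρ φ) hx φ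
  have h0 : fourierY (u (Real.toNNReal 0)) = fourierY (u 0) := by rw [Real.toNNReal_zero]
  exact h.trans (DFunLike.congr_fun h0 _)

theorem IsSolution.fourierY_zero_apply (hε : 0 < ε) (hν : 0 < ν) (hkx : 0 < kx) (hky : ky ≠ 0)
    (hk : kx ^ 2 + ky ^ 2 = 1) {g : 𝓢'(ℝ, ℂ)} {u : C(ℝ≥0, 𝓢'(ℝ, ℂ))}
    (hu : IsSolution ε ν kx ky g u) (φ : 𝓢(ℝ, ℂ)) :
    fourierY (u 0) φ = fourierY g (SchwartzMap.smulLeftCLM ℂ (transmission ε ν kx ky) φ) := by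
  obtain ⟨w, hw, hbd⟩ := hu.boundary
  have hr := hasTemperateGrowth_Rminus hε hν hkx hky
  have hs := hasTemperateGrowth_transmission hε hν hkx hky
  have hre : ∀ η, (Rminus ε ν kx ky η).re ≤ 0 := fun η => (Rminus_re_neg hε hν hkx hky η).le
  have hwr : ∀ φ, fourierY w φ =
      fourierY (u 0) (SchwartzMap.smulLeftCLM ℂ (Rminus ε ν kx ky) φ) := by
    intro φ
    have h1 := hasDerivWithinAt_clm_curve (fourierY (u 0) : 𝓢(ℝ, ℂ) →L[ℂ] ℂ)
      (tendsto_slope_mulExp hr hre le_rfl φ)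
    rw [mulExp_zero] at h1
    have h2 := hw (schwartzFourier φ)
    refine (uniqueDiffOn_Ici (0 : ℝ) 0 (Set.mem_Ici.2 le_rfl)).eq_deriv _ h2
      (h1.congr (fun t ht => ?_) ?_)
    · exact hu.fourierY_apply_eq hε hν hkx hky hk ht φ
    · exact hu.fourierY_apply_eq hε hν hkx hky hk le_rfl φ
  have h3 := congrArg (fun S => fourierY S (SchwartzMap.smulLeftCLM ℂ (transmission ε ν kx ky) φ))
    hbd
  simp only [map_add, map_sub, map_smul] at h3
  change (Complex.I * ε * ky) * (kx * fourierY (TemperedDistribution.derivCLM ℂ (u 0)) _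
    - ky * fourierY w _) + (2 * kx) * fourierY (u 0) _ = (2 * kx) * fourierY g _ at h3
  rw [fourierY_derivCLM, hwr] at h3
  have hkx' : (2 * kx : ℂ) ≠ 0 := mul_ne_zero two_ne_zero (by exact_mod_cast hkx.ne')
  refine mul_left_cancel₀ hkx' (Eq.trans ?_ h3)
  have h4 : ∀ (c : ℂ) (ψ : 𝓢(ℝ, ℂ)), c * fourierY (u 0) ψ = fourierY (u 0) (c • ψ) := fun c ψ => by
    rw [map_smul, smul_eq_mul]
  simp only [h4, ← map_add, ← map_sub]
  congr 1
  ext η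
  simp only [add_apply, sub_apply, smul_apply, smul_eq_mul, smulLeft_apply hr,
    smulLeft_apply hasTemperateGrowth_iEta, iEta, smulLeft_apply hs]
  have h5 := boundary_symbol (ν := ν) (kx := kx) hε hky η
  have h6 : transmission ε ν kx ky η * (1 + rootS ε ν kx ky η) = 2 :=
    div_mul_cancel₀ _ (one_add_rootS_ne_zero η)
  linear_combination -transmission ε ν kx ky η * φ η * h5 - kx * φ η * h6

theorem IsSolution.fourierY_eq (hε : 0 < ε) (hν : 0 < ν) (hkx : 0 < kx) (hky : ky ≠ 0)
    (hk : kx ^ 2 + ky ^ 2 = 1) {g : 𝓢'(ℝ, ℂ)} {u : C(ℝ≥0, 𝓢'(ℝ, ℂ))}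
    (hu : IsSolution ε ν kx ky g u) (x : ℝ≥0) :
    fourierY (u x) = TemperedDistribution.smulLeftCLM ℂ (propagator ε ν kx ky x) (fourierY g) := by
  ext φ
  have h := hu.fourierY_apply_eq hε hν hkx hky hk (NNReal.coe_nonneg x) φ
  rw [Real.toNNReal_coe] at h
  exact (h.trans (hu.fourierY_zero_apply hε hν hkx hky hk _)).trans
    (smulLeft_propagator hε hν hkx hky g (NNReal.coe_nonneg x) φ).symm

end Uniqueness

end TiltedParaxial

end

theorem proposition2 (ε ν kx ky : ℝ) (hε : 0 < ε) (hν : 0 < ν) (hkx : 0 < kx) (hky : ky ≠ 0)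
    (hk : kx ^ 2 + ky ^ 2 = 1) (g : 𝓢'(ℝ, ℂ)) :
    (∃! u : C(ℝ≥0, 𝓢'(ℝ, ℂ)), TiltedParaxial.IsSolution ε ν kx ky g u) ∧
    (∀ η : ℝ, (TiltedParaxial.Rminus ε ν kx ky η).re < 0) ∧
    (TiltedParaxial.Rminus ε ν kx ky).HasTemperateGrowth ∧
    (∀ x : ℝ≥0, (TiltedParaxial.propagator ε ν kx ky x).HasTemperateGrowth) ∧
    ∀ u : C(ℝ≥0, 𝓢'(ℝ, ℂ)), TiltedParaxial.IsSolution ε ν kx ky g u →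
      (∀ x : ℝ≥0, TiltedParaxial.fourierY (u x) =
        TemperedDistribution.smulLeftCLM ℂ (TiltedParaxial.propagator ε ν kx ky x)
          (TiltedParaxial.fourierY g)) ∧
      (∀ x : ℝ≥0, TiltedParaxial.HasXDerivAt (fun t => TiltedParaxial.fourierY (u t))
        (TemperedDistribution.smulLeftCLM ℂ (TiltedParaxial.Rminus ε ν kx ky)
          (TiltedParaxial.fourierY (u x))) x) := by
  have hF : ∀ u : C(ℝ≥0, 𝓢'(ℝ, ℂ)), TiltedParaxial.IsSolution ε ν kx ky g u → ∀ x : ℝ≥0,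
      TiltedParaxial.fourierY (u x) = TemperedDistribution.smulLeftCLM ℂ
        (TiltedParaxial.propagator ε ν kx ky x) (TiltedParaxial.fourierY g) :=
    fun u hu => hu.fourierY_eq hε hν hkx hky hk
  refine ⟨⟨_, TiltedParaxial.isSolution_solution hε hν hkx hky hk g, fun u hu => ?_⟩,
    TiltedParaxial.Rminus_re_neg hε hν hkx hky, TiltedParaxial.hasTemperateGrowth_Rminus hε hν hkx hky,
    fun x => TiltedParaxial.hasTemperateGrowth_propagator hε hν hkx hky x.2,
    fun u hu => ⟨hF u hu, TiltedParaxial.hasXDerivAt_of_fourierY_eq hε hν hkx hky (hF u hu)⟩⟩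
  refine ContinuousMap.ext fun x => TiltedParaxial.fourierY_injective ?_
  exact (hF u hu x).trans (TiltedParaxial.fourierY_solution ε ν kx ky g x).symm
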